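/- Fix the set $\Sigma=\{0,1\}^*$ of predicate labels. An (occurrence) interval is $[n;m]=\{i\in\mathbb N\mid n\le i\le m\}$ with $n\in\mathbb N$, $n\le m\le\infty$; the sum of intervals is $[n_1;m_1]\oplus[n_2;m_2]=[n_1+n_2;m_1+m_2]$, and the empty sum is $[0;0]$. The basic intervals are $\mathtt 1=[1;1]$, $\mathtt ?=[0;1]$, $\mathtt +=[1;\infty]$, $\mathtt *=[0;\infty]$. A *graph* $G$ has a finite set $N_G$ of nodes and a finite set $E_G$ of edges; every edge $e$ has a source, a target, a label $\mathrm{lab}_G(e)\in\Sigma$ and an interval $\mathrm{occur}_G(e)$ (parallel edges are allowed). Let $\mathrm{out}_G(n)$ be the set of edges with source $n$. $G$ is *simple* if it uses only the interval $\mathtt 1$ and no two distinct edges have the same source, target and label. $G$ is a *shape graph* if it uses basic intervals only. A relation $R\subseteq N_G\times N_H$ is a *simulation* of $G$ in $H$ if for every $(n,m)\in R$ there is a function $\lambda:\mathrm{out}_G(n)\to\mathrm{out}_H(m)$ such that for every $e\in\mathrm{out}_G(n)$ the edges $e$ and $\lambda(e)$ have the same label and their targets are related by $R$, and such that for every $f\in\mathrm{out}_H(m)$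 one has $\bigoplus\{\mathrm{occur}_G(e)\mid\lambda(e)=f\}\subseteq\mathrm{occur}_H(f)$. We write $G\preccurlyeq H$ if there is a simulation of $G$ in $H$ whose domain is all of $N_G$. The language of $H$ is $L(H)=\{G\text{ simple}\mid G\preccurlyeq H\}$, and $H$ is *contained* in $K$, written $H\subseteq K$, if $L(H)\subseteq L(K)$. A *reference* to a node $t$ of a shape graph $H$ is an edge with target $t$. The *$\mathtt *$-closed* references form the least set of edges such that an edge $e$ belongs to it whenever $\mathrm{occur}_H(e)=\mathtt *$, or the source of $e$ is referenced at least once and all references to the source of $e$ belong to the set. The class $\mathsf{DetShEx}_0^-$ consists of the shape graphs that are deterministic (no node has two distinct outgoing edges with the same label), do not use $\mathtt +$, and in which every node with an outgoing $\mathtt ?$-edge is referenced at least once and all references to it are $\mathtt *$-closed. **Theorem.** Containment for $\mathsf{DetShEx}_0^-$ is in $\mathrm P$: there is a Turing machine that, given a word, decides in time polynomial in the length of the word whether the word encodes a pair of shape graphs $H,K\in\mathsf{DetShEx}_0^-$ with $H\subseteq K$. (Here a graph is written as a list of its nodes followed by a list of its edges, each edge with its interval, source, label and target; nodes are named by binary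 words.) -/

import Mathlib

/-! ### Intervals -/

/-- An occurrence interval `[lo; hi]` of natural numbers, with `lo ≤ hi ≤ ∞`. -/
structure OccInterval where
  lo : ℕ
  hi : ℕ∞
  lo_le_hi : (lo : ℕ∞) ≤ hi

namespace OccInterval

/-- The set of natural numbers represented by an interval. -/
def toSet (I : OccInterval) : Set ℕ := {i | I.lo ≤ i ∧ (i : ℕ∞) ≤ I.hi}

/-- The point-wise sum of a finite family of intervals: lower bounds and upper bounds are added
(so the empty sum is `[0; 0]`). -/
def sum {ι : Type} (s : Finset ι) (I : ι → OccInterval) : OccInterval where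
  lo := ∑ i ∈ s, (I i).lo
  hi := ∑ i ∈ s, (I i).hi
  lo_le_hi := by
    rw [Nat.cast_sum]
    exact Finset.sum_le_sum fun i _ => (I i).lo_le_hi

end OccInterval

/-- The four basic intervals `1 = [1;1]`, `? = [0;1]`, `+ = [1;∞]`, `* = [0;∞]`. -/
inductive BasicInterval where
  | one
  | opt
  | plus
  | star
  deriving DecidableEq

instance : Fintype BasicInterval where
  elems := {.one, .opt, .plus, .star}
  complete := by intro x; cases x <;> decide

/-- The interval denoted by a basic interval. -/
def BasicInterval.toInterval : BasicInterval → OccInterval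
  | .one => ⟨1, 1, by simp⟩
  | .opt => ⟨0, 1, by simp⟩
  | .plus => ⟨1, ⊤, by simp⟩
  | .star => ⟨0, ⊤, by simp⟩

/-! ### Graphs, simulations, embeddings, languages -/

/-- A (general) graph over a set `S` of predicate labels: finitely many nodes and edges (parallel
edges are allowed), each edge carrying a label and an occurrence interval. -/
structure LGraph (S : Type) where
  Node : Type
  Edge : Type
  [nodeFintype : Fintype Node]
  [edgeFintype : Fintype Edge]
  source : Edge → Node
  target : Edge → Node
  lab : Edge → S
  occur : Edge → OccInterval

attribute [instance] LGraph.nodeFintype LGraph.edgeFintype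

namespace LGraph

variable {S : Type}

/-- The outgoing edges of a node. -/
abbrev Out (G : LGraph S) (n : G.Node) : Type := {e : G.Edge // G.source e = n}

/-- A graph is simple if it uses only the interval `1` and no two distinct edges agree on origin,
end point and label. -/
def IsSimple (G : LGraph S) : Prop :=
  (∀ e, G.occur e = BasicInterval.one.toInterval) ∧
  ∀ e e', G.source e = G.source e' → G.target e = G.target e' → G.lab e = G.lab e' → e = e'

open Classical in
/-- `w` is a witness of simulation of the node `n` of `G` by the node `m` of `H` w.r.t. `R`. -/
def IsWitness (G H : LGraph S) (R : G.Node → H.Node → Prop) (n : G.Node) (m : H.Node)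
    (w : G.Out n → H.Out m) : Prop :=
  (∀ e, G.lab e.1 = H.lab (w e).1) ∧
  (∀ e, R (G.target e.1) (H.target (w e).1)) ∧
  ∀ f : H.Out m,
    (OccInterval.sum (Finset.univ.filter fun e => w e = f) fun e => G.occur e.1).toSet ⊆
      (H.occur f.1).toSet

/-- `R` is a simulation of `G` in `H`. -/
def IsSimulation (G H : LGraph S) (R : G.Node → H.Node → Prop) : Prop :=
  ∀ n m, R n m → ∃ w : G.Out n → H.Out m, IsWitness G H R n m w

/-- `G` can be embedded in `H`: some simulation of `G` in `H` has all nodes of `G` as domain. -/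
def Embeds (G H : LGraph S) : Prop :=
  ∃ R : G.Node → H.Node → Prop, IsSimulation G H R ∧ ∀ n, ∃ m, R n m

/-- The language of `H`: all simple graphs that can be embedded in `H`. -/
def language (H : LGraph S) : Set (LGraph S) := {G | G.IsSimple ∧ Embeds G H}

/-- Containment `H ⊆ K`: inclusion of the languages. -/
def Contained (H K : LGraph S) : Prop := H.language ⊆ K.language

/-! ### The class `DetShEx₀⁻` -/

/-- A shape graph uses only basic occurrence intervals. -/
def IsShapeGraph (H : LGraph S) : Prop := ∀ e, ∃ M : BasicInterval, H.occur e = M.toInterval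

/-- Every node has at most one outgoing edge with a given label. -/
def IsDeterministic (H : LGraph S) : Prop :=
  ∀ e e', H.source e = H.source e' → H.lab e = H.lab e' → e = e'

/-- `*`-closed references (edges), as an inductive notion: `e` is `*`-closed if its interval is `*`,
or if its source is referenced at least once and all references to its source are `*`-closed. -/
inductive StarClosed (H : LGraph S) : H.Edge → Prop where
  | star (e : H.Edge) (he : H.occur e = BasicInterval.star.toInterval) : StarClosed H e
  | step (e : H.Edge) (hne : ∃ e', H.target e' = H.source e)
      (hall : ∀ e', H.target e' = H.source e → StarClosed H e') : StarClosed H e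

/-- The class `DetShEx₀⁻`: deterministic shape graphs that do not use `+` and in which every node
with an outgoing `?`-edge is referenced at least once and only by `*`-closed references. -/
structure IsDetShExZeroMinus (H : LGraph S) : Prop where
  shape : H.IsShapeGraph
  deterministic : H.IsDeterministic
  no_plus : ∀ e, H.occur e ≠ BasicInterval.plus.toInterval
  opt_closed : ∀ t, (∃ e, H.source e = t ∧ H.occur e = BasicInterval.opt.toInterval) →
    (∃ e, H.target e = t) ∧ ∀ e, H.target e = t → H.StarClosed e

end LGraph

/-! ### Encoding of shape graphs as words -/

/-- Binary words. They serve as predicate labels and as names of nodes. -/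
abbrev BWord : Type := List Bool

/-- An edge in the written form of a shape graph. -/
structure EdgeCode where
  src : BWord
  lab : BWord
  occ : BasicInterval
  tgt : BWord

/-- The written form of a shape graph: a list of nodes and a list of edges. The nodes of the graph
are all the words that are listed as a node or occur as an end of an edge. -/
structure GraphCode where
  nodes : List BWord
  edges : List EdgeCode

namespace GraphCode

/-- All node names occurring in a written graph (possibly with repetitions). -/
def nodeNames (c : GraphCode) : List BWord :=
  c.nodes ++ c.edges.flatMap fun e => [e.src, e.tgt]

theorem src_mem (c : GraphCode) (i : Fin c.edges.length) : (c.edges.get i).src ∈ c.nodeNames :=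
  List.mem_append_right _
    (List.mem_flatMap.2 ⟨c.edges.get i, List.get_mem _ _, List.mem_cons_self⟩)

theorem tgt_mem (c : GraphCode) (i : Fin c.edges.length) : (c.edges.get i).tgt ∈ c.nodeNames :=
  List.mem_append_right _
    (List.mem_flatMap.2 ⟨c.edges.get i, List.get_mem _ _,
      List.mem_cons_of_mem _ List.mem_cons_self⟩)

/-- The shape graph described by a written form. The edges are the entries of the edge list. -/
def toGraph (c : GraphCode) : LGraph BWord where
  Node := {x : BWord // x ∈ c.nodeNames}
  Edge := Fin c.edges.length
  source i := ⟨(c.edges.get i).src, c.src_mem i⟩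
  target i := ⟨(c.edges.get i).tgt, c.tgt_mem i⟩
  lab i := (c.edges.get i).lab
  occur i := (c.edges.get i).occ.toInterval

end GraphCode

/-- The finite alphabet in which pairs of shape graphs are written. -/
inductive GSymbol where
  | bit (b : Bool)
  | node
  | edge (M : BasicInterval)
  | sep
  | endGraph
  deriving DecidableEq, Fintype

/-- A binary word over the alphabet `GSymbol`. -/
def encodeWord (x : BWord) : List GSymbol := x.map GSymbol.bit

/-- `node x` for a listed node `x`. -/
def encodeNode (x : BWord) : List GSymbol := GSymbol.node :: encodeWord x

/-- `edge_M x sep a sep y` for an edge from `x` to `y` with label `a` and interval `M`. -/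
def EdgeCode.encode (e : EdgeCode) : List GSymbol :=
  GSymbol.edge e.occ :: (encodeWord e.src ++ GSymbol.sep :: (encodeWord e.lab ++
    GSymbol.sep :: encodeWord e.tgt))

/-- A graph is written as its nodes, then its edges, then an end marker. -/
def GraphCode.encode (c : GraphCode) : List GSymbol :=
  c.nodes.flatMap encodeNode ++ c.edges.flatMap EdgeCode.encode ++ [GSymbol.endGraph]

/-- The containment problem for a class `C` of shape graphs: the set of all words that encode a pair
of graphs `H`, `K` in `C` with `H ⊆ K`. -/
def containmentProblem (C : LGraph BWord → Prop) : Set (List GSymbol) :=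
  {w | ∃ H K : GraphCode, w = H.encode ++ K.encode ∧ C H.toGraph ∧ C K.toGraph ∧
    H.toGraph.Contained K.toGraph}

/-! ### Polynomial time -/

/-- The complexity class P: a set `L` of words over a finite alphabet is in P if some (multi-stack)
Turing machine, started on any word `w`, halts within a number of steps that is polynomial in the
length of `w` and outputs the bit that says whether `w ∈ L`. -/
def InPolyTime {A : Type} [Fintype A] (L : Set (List A)) : Prop :=
  ∃ f : List A → Bool, (∀ w, f w = true ↔ w ∈ L) ∧
    Nonempty (Turing.TM2ComputableInPolyTime (id : List A → List A) Computability.encodeBool f)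

/-! ### Intervals and sums of intervals -/

namespace OccInterval

theorem toSet_subset_iff (I J : OccInterval) :
    I.toSet ⊆ J.toSet ↔ J.lo ≤ I.lo ∧ I.hi ≤ J.hi := by
  constructor
  · intro h
    have h1 : J.lo ≤ I.lo := (h (show I.lo ∈ I.toSet from ⟨le_rfl, I.lo_le_hi⟩)).1
    refine ⟨h1, ?_⟩
    refine ENat.forall_natCast_le_iff_le.1 fun n hn => ?_
    by_cases hl : I.lo ≤ n
    · exact (h (show n ∈ I.toSet from ⟨hl, hn⟩)).2
    · have : (n : ℕ∞) ≤ I.lo := by exact_mod_cast (not_le.1 hl).le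
      exact this.trans (h (show I.lo ∈ I.toSet from ⟨le_rfl, I.lo_le_hi⟩)).2
  · rintro ⟨h1, h2⟩ i ⟨h3, h4⟩
    exact ⟨h1.trans h3, h4.trans h2⟩

theorem sum_toSet_subset_iff {ι : Type} (s : Finset ι) (I : ι → OccInterval) (J : OccInterval) :
    (sum s I).toSet ⊆ J.toSet ↔ J.lo ≤ ∑ i ∈ s, (I i).lo ∧ ∑ i ∈ s, (I i).hi ≤ J.hi :=
  toSet_subset_iff _ _

theorem zero_mem_toSet_iff (J : OccInterval) : 0 ∈ J.toSet ↔ J.lo = 0 := by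
  simp [toSet]

theorem sum_empty_toSet_subset_iff {ι : Type} (I : ι → OccInterval) (J : OccInterval) :
    (sum ∅ I).toSet ⊆ J.toSet ↔ 0 ∈ J.toSet := by
  rw [sum_toSet_subset_iff, zero_mem_toSet_iff]
  simp

theorem sum_singleton_toSet {ι : Type} (i : ι) (I : ι → OccInterval) :
    (sum {i} I).toSet = (I i).toSet := by
  simp [sum, toSet]

end OccInterval

namespace LGraph

variable {S : Type}

/-! ### Embeddings compose -/

open Classical in
theorem IsSimulation.comp {G H K : LGraph S} {R : G.Node → H.Node → Prop}
    {Q : H.Node → K.Node → Prop} (hR : IsSimulation G H R) (hQ : IsSimulation H K Q) :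
    IsSimulation G K fun n k => ∃ m, R n m ∧ Q m k := by
  rintro n k ⟨m, hnm, hmk⟩
  obtain ⟨v, v1, v2, v3⟩ := hR n m hnm
  obtain ⟨w, w1, w2, w3⟩ := hQ m k hmk
  refine ⟨fun e => w (v e), fun e => (v1 e).trans (w1 _), fun e => ⟨_, v2 e, w2 _⟩, fun f => ?_⟩
  have hw := (OccInterval.sum_toSet_subset_iff _ _ _).1 (w3 f)
  have hv := fun g => (OccInterval.sum_toSet_subset_iff _ _ _).1 (v3 g)
  rw [OccInterval.sum_toSet_subset_iff]
  have key : ∀ {M : Type} [AddCommMonoid M] (F : G.Out n → M),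
      ∑ e with w (v e) = f, F e = ∑ g with w g = f, ∑ e with v e = g, F e := by
    intro M _ F
    have h := Finset.sum_fiberwise_of_maps_to (s := Finset.univ.filter fun e => w (v e) = f)
      (t := Finset.univ.filter fun g => w g = f) (g := v) (fun e he => by simpa using he) F
    rw [← h]
    refine Finset.sum_congr rfl fun g hg => Finset.sum_congr ?_ fun _ _ => rfl
    ext e
    simp only [Finset.mem_filter, Finset.mem_univ, true_and] at hg ⊢
    constructor
    · exact fun h => h.2
    · rintro rfl
      exact ⟨hg, rfl⟩
  constructor
  · rw [key]
    exact hw.1.trans (Finset.sum_le_sum fun g _ => (hv g).1)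
  · rw [key]
    exact (Finset.sum_le_sum fun g _ => (hv g).2).trans hw.2

theorem Embeds.trans {G H K : LGraph S} (h1 : Embeds G H) (h2 : Embeds H K) : Embeds G K := by
  obtain ⟨R, hR, hRd⟩ := h1
  obtain ⟨Q, hQ, hQd⟩ := h2
  refine ⟨_, hR.comp hQ, fun n => ?_⟩
  obtain ⟨m, hm⟩ := hRd n
  obtain ⟨k, hk⟩ := hQd m
  exact ⟨k, m, hm, hk⟩

theorem Embeds.contained {H K : LGraph S} (h : Embeds H K) : Contained H K :=
  fun _ hG => ⟨hG.1, hG.2.trans h⟩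

/-! ### Simulations between deterministic graphs -/

/-- The local condition that a pair of nodes has to satisfy in a simulation between deterministic
graphs. -/
def DetLocal (H K : LGraph S) (R : H.Node → K.Node → Prop) (n : H.Node) (m : K.Node) : Prop :=
  (∀ e, H.source e = n → ∃ f, K.source f = m ∧ H.lab e = K.lab f ∧ R (H.target e) (K.target f) ∧
    (H.occur e).toSet ⊆ (K.occur f).toSet) ∧
  ∀ f, K.source f = m → 0 ∈ (K.occur f).toSet ∨ ∃ e, H.source e = n ∧ H.lab e = K.lab f

open Classical in
theorem isSimulation_iff_of_deterministic {H K : LGraph S} (hH : H.IsDeterministic)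
    (hK : K.IsDeterministic) (R : H.Node → K.Node → Prop) :
    IsSimulation H K R ↔ ∀ n m, R n m → DetLocal H K R n m := by
  refine forall_congr' fun n => forall_congr' fun m => imp_congr_right fun _ => ?_
  have single : ∀ (w : H.Out n → K.Out m), (∀ e, H.lab e.1 = K.lab (w e).1) → ∀ e,
      (Finset.univ.filter fun e' => w e' = w e) = {e} := by
    intro w hw e
    ext e'
    simp only [Finset.mem_filter, Finset.mem_univ, true_and, Finset.mem_singleton]
    refine ⟨fun h => Subtype.ext (hH _ _ (e'.2.trans e.2.symm) ?_), fun h => h ▸ rfl⟩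
    rw [hw, hw, h]
  constructor
  · rintro ⟨w, w1, w2, w3⟩
    refine ⟨fun e he => ?_, fun f hf => ?_⟩
    · refine ⟨(w ⟨e, he⟩).1, (w ⟨e, he⟩).2, w1 ⟨e, he⟩, w2 ⟨e, he⟩, ?_⟩
      have := w3 (w ⟨e, he⟩)
      rwa [single w w1, OccInterval.sum_singleton_toSet] at this
    · by_cases h : ∃ e, w e = ⟨f, hf⟩
      · obtain ⟨e, he⟩ := h
        exact Or.inr ⟨e.1, e.2, by rw [w1, he]⟩
      · left
        have := w3 ⟨f, hf⟩
        rwa [Finset.filter_false_of_mem (fun e _ he => h ⟨e, he⟩),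
          OccInterval.sum_empty_toSet_subset_iff] at this
  · rintro ⟨h1, h2⟩
    choose w hw1 hw2 hw3 hw4 using h1
    refine ⟨fun e => ⟨w e.1 e.2, hw1 e.1 e.2⟩, fun e => hw2 e.1 e.2, fun e => hw3 e.1 e.2,
      fun f => ?_⟩
    by_cases h : ∃ e : H.Out n, (⟨w e.1 e.2, hw1 e.1 e.2⟩ : K.Out m) = f
    · obtain ⟨e, rfl⟩ := h
      rw [single (fun e => ⟨w e.1 e.2, hw1 e.1 e.2⟩) (fun e => hw2 e.1 e.2) e,
        OccInterval.sum_singleton_toSet]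
      exact hw4 e.1 e.2
    · rw [Finset.filter_false_of_mem (fun e _ he => h ⟨e, he⟩),
          OccInterval.sum_empty_toSet_subset_iff]
      refine (h2 f.1 f.2).resolve_right ?_
      rintro ⟨e, he, hl⟩
      refine h ⟨⟨e, he⟩, Subtype.ext (hK _ _ ((hw1 e he).trans f.2.symm) ?_)⟩
      rw [← hw2, hl]

/-! ### The characterizing graph -/

/-- A node is closed if it is referenced, and by `*`-closed references only. -/
def NodeClosed (H : LGraph S) (t : H.Node) : Prop :=
  (∃ e, H.target e = t) ∧ ∀ e, H.target e = t → H.StarClosed e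

/-- `s` has an edge into the closed node `t` whose interval is not `*`. -/
def RigidEdge (H : LGraph S) (s t : H.Node) : Prop :=
  H.NodeClosed t ∧ ∃ e, H.source e = s ∧ H.target e = t ∧
    H.occur e ≠ BasicInterval.star.toInterval

theorem StarClosed.source_nodeClosed {H : LGraph S} {e : H.Edge} (h : H.StarClosed e)
    (hs : H.occur e ≠ BasicInterval.star.toInterval) : H.NodeClosed (H.source e) := by
  cases h with
  | star _ he => exact absurd he hs
  | step _ hne hall => exact ⟨hne, hall⟩

theorem RigidEdge.source_nodeClosed {H : LGraph S} {s t : H.Node} (h : H.RigidEdge s t) :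
    H.NodeClosed s := by
  obtain ⟨ht, e, rfl, rfl, he⟩ := h
  exact (ht.2 e rfl).source_nodeClosed he

theorem rigidEdge_wellFounded (H : LGraph S) : WellFounded H.RigidEdge := by
  have key : ∀ e, H.StarClosed e → H.occur e ≠ BasicInterval.star.toInterval →
      Acc H.RigidEdge (H.source e) := by
    intro e he
    induction he with
    | star e he => exact fun h => absurd he h
    | step e hne hall ih =>
      intro _
      refine ⟨_, fun s hs => ?_⟩
      obtain ⟨ht, e', rfl, h2, h3⟩ := hs
      exact ih e' h2 h3
  refine ⟨fun t => ⟨_, fun s hs => ?_⟩⟩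
  obtain ⟨ht, e, rfl, rfl, he⟩ := hs
  exact key e (ht.2 e rfl) he

/-- The numbers of relevant copies of the nodes in the characterizing graph. -/
theorem exists_copies (H : LGraph S) : ∃ c : H.Node → ℕ, (∀ n, ¬ H.NodeClosed n → c n = 1) ∧
    (∀ n, H.NodeClosed n → 2 ≤ c n) ∧ ∀ s t, H.RigidEdge s t → c t + 1 ≤ c s := by
  classical
  let r := Relation.TransGen H.RigidEdge
  have hr : WellFounded r := H.rigidEdge_wellFounded.transGen
  refine ⟨fun n => if H.NodeClosed n then 2 + (Finset.univ.filter fun t => r n t).card else 1,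
    fun n hn => if_neg hn, fun n hn => by simp [hn], fun s t h => ?_⟩
  simp only [h.source_nodeClosed, h.1, if_true]
  have : (Finset.univ.filter fun u => r t u).card < (Finset.univ.filter fun u => r s u).card := by
    refine Finset.card_lt_card ((Finset.ssubset_iff_of_subset fun u hu => ?_).2 ⟨t, ?_, ?_⟩)
    · simp only [Finset.mem_filter, Finset.mem_univ, true_and] at hu ⊢
      exact Relation.TransGen.head h hu
    · simpa using Relation.TransGen.single h
    · simpa using hr.irrefl.irrefl t
  omega

/-- The edges of the graph of `M` copies of the nodes of `H`: a `*`-edge is present between all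
copies, a `1`-edge between copies with the same number, and a `?`-edge between copies with the same
small number. -/
def CopyEdge (H : LGraph S) (c : H.Node → ℕ) (e : H.Edge) (i j : ℕ) : Prop :=
  H.occur e = BasicInterval.star.toInterval ∨
    i = j ∧ (H.occur e = BasicInterval.opt.toInterval → i + 1 < c (H.source e))

open Classical in
/-- The graph of `M` copies of the nodes of `H`. -/
noncomputable def copyGraph (H : LGraph S) (c : H.Node → ℕ) (M : ℕ) : LGraph S where
  Node := H.Node × Fin M
  Edge := {p : H.Edge × Fin M × Fin M // H.CopyEdge c p.1 p.2.1 p.2.2}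
  source p := (H.source p.1.1, p.1.2.1)
  target p := (H.target p.1.1, p.1.2.2)
  lab p := H.lab p.1.1
  occur _ := BasicInterval.one.toInterval

theorem copyGraph_isSimple {H : LGraph S} (hH : H.IsDeterministic) (c : H.Node → ℕ) (M : ℕ) :
    (H.copyGraph c M).IsSimple := by
  refine ⟨fun _ => rfl, ?_⟩
  rintro ⟨⟨e, i, j⟩, h⟩ ⟨⟨e', i', j'⟩, h'⟩ hs ht hl
  simp only [copyGraph, Prod.mk.injEq] at hs ht hl
  obtain ⟨hs, rfl⟩ := hs
  obtain ⟨ht, rfl⟩ := ht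
  obtain rfl := hH e e' hs hl
  rfl

theorem _root_.BasicInterval.toInterval_injective : Function.Injective BasicInterval.toInterval := by
  intro a b h
  have h1 := congrArg OccInterval.lo h
  have h2 := congrArg OccInterval.hi h
  cases a <;> cases b <;> simp_all [BasicInterval.toInterval]

open Classical in
theorem copyGraph_embeds {H : LGraph S} (hH : H.IsDetShExZeroMinus) (c : H.Node → ℕ) (M : ℕ) :
    (H.copyGraph c M).Embeds H := by
  refine ⟨fun p n => p.1 = n, ?_, fun n => ⟨n.1, rfl⟩⟩
  rintro ⟨n, i⟩ _ rfl
  have hsrc : ∀ e : (H.copyGraph c M).Out (n, i), H.source e.1.1.1 = n := fun e =>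
    congrArg Prod.fst e.2
  have hidx : ∀ e : (H.copyGraph c M).Out (n, i), e.1.1.2.1 = i := fun e =>
    congrArg Prod.snd e.2
  refine ⟨fun e => ⟨e.1.1.1, hsrc e⟩, fun e => rfl, fun e => rfl, ?_⟩
  rintro ⟨f, hfn⟩
  change H.source f = n at hfn
  subst hfn
  rw [OccInterval.sum_toSet_subset_iff]
  obtain ⟨B, hB⟩ := hH.shape f
  have hocc : ∀ e, (H.copyGraph c M).occur e = BasicInterval.one.toInterval := fun _ => rfl
  simp only [hB, hocc]
  have hcard : B ≠ BasicInterval.star → (Finset.univ.filter fun e :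
      (H.copyGraph c M).Out (H.source f, i) =>
        (⟨e.1.1.1, hsrc e⟩ : H.Out (H.source f)) = ⟨f, rfl⟩).card ≤ 1 := by
    intro hne
    have hf : H.occur f ≠ BasicInterval.star.toInterval := by
      rw [hB]
      exact fun h => hne (BasicInterval.toInterval_injective h)
    refine Finset.card_le_one.2 fun x hx y hy => ?_
    simp only [Finset.mem_filter, Finset.mem_univ, true_and, Subtype.mk.injEq] at hx hy
    have hx' := x.1.2
    have hy' := y.1.2
    rw [CopyEdge, hx] at hx'
    rw [CopyEdge, hy] at hy'
    have ex := (hx'.resolve_left hf).1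
    have ey := (hy'.resolve_left hf).1
    rw [hidx] at ex ey
    refine Subtype.ext (Subtype.ext (Prod.ext (hx.trans hy.symm)
      (Prod.ext ((hidx x).trans (hidx y).symm) (Fin.ext (ex.symm.trans ey)))))
  cases B with
  | one =>
    have h1 : 0 < (Finset.univ.filter fun e :
      (H.copyGraph c M).Out (H.source f, i) =>
        (⟨e.1.1.1, hsrc e⟩ : H.Out (H.source f)) = ⟨f, rfl⟩).card := by
      refine Finset.card_pos.2 ⟨⟨⟨(f, i, i), Or.inr ⟨rfl, fun h => ?_⟩⟩, rfl⟩, by simp⟩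
      exact absurd (BasicInterval.toInterval_injective (hB.symm.trans h)) (by decide)
    have h2 := hcard (by decide)
    simp only [BasicInterval.toInterval, Finset.sum_const, smul_eq_mul, mul_one, nsmul_eq_mul]
    exact ⟨h1, by exact_mod_cast h2⟩
  | opt =>
    have h2 := hcard (by decide)
    simp only [BasicInterval.toInterval, Finset.sum_const, smul_eq_mul, mul_one, nsmul_eq_mul]
    exact ⟨Nat.zero_le _, by exact_mod_cast h2⟩
  | plus => exact absurd hB (hH.no_plus f)
  | star => simp [BasicInterval.toInterval]

/-- A basic interval other than `+` that contains a number greater than one is `*`. -/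
theorem eq_star_of_mem {K : LGraph S} (hK : K.IsShapeGraph)
    (hp : ∀ e, K.occur e ≠ BasicInterval.plus.toInterval) (f : K.Edge) {k : ℕ} (hk : 2 ≤ k)
    (h : k ∈ (K.occur f).toSet) : K.occur f = BasicInterval.star.toInterval := by
  obtain ⟨B, hB⟩ := hK f
  rw [hB] at h
  have h2 := h.2
  cases B with
  | one =>
    have : k ≤ 1 := by simpa [BasicInterval.toInterval] using h2
    omega
  | opt =>
    have : k ≤ 1 := by simpa [BasicInterval.toInterval] using h2
    omega
  | plus => exact absurd hB (hp f)
  | star => exact hB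

open Classical in
/-- For graphs in `DetShEx₀⁻`, containment is embedding. -/
theorem contained_iff_embeds {H K : LGraph S} (hH : H.IsDetShExZeroMinus)
    (hK : K.IsDetShExZeroMinus) : Contained H K ↔ Embeds H K := by
  refine ⟨fun hcont => ?_, Embeds.contained⟩
  obtain ⟨c, c1, c2, c3⟩ := H.exists_copies
  have hrigid : ∀ e, H.occur e ≠ BasicInterval.star.toInterval →
      H.NodeClosed (H.target e) → c (H.target e) + 1 ≤ c (H.source e) :=
    fun e he ht => c3 _ _ ⟨ht, e, rfl, rfl, he⟩
  have cpos : ∀ n, 1 ≤ c n := fun n => by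
    by_cases h : H.NodeClosed n
    · exact (c2 n h).trans' (by norm_num)
    · exact (c1 n h).ge
  let M := 2 + ∑ n, c n
  have hM2 : 2 ≤ M := Nat.le_add_right _ _
  have hcM : ∀ n, c n ≤ M := fun n =>
    (Finset.single_le_sum (f := c) (fun _ _ => Nat.zero_le _) (Finset.mem_univ n)).trans
      (Nat.le_add_left _ _)
  let G := H.copyGraph c M
  obtain ⟨-, Q, hQ, hQd⟩ := hcont ⟨copyGraph_isSimple hH.deterministic c M,
    copyGraph_embeds hH c M⟩
  let R : H.Node → K.Node → Prop := fun n m => ∀ i : Fin M, (i : ℕ) < c n → Q (n, i) m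
  have copy_congr : ∀ {e e' : H.Edge} {i i' j : Fin M}, e = e' → i = i' →
      H.CopyEdge c e i j → H.CopyEdge c e' i' j := by
    rintro _ _ _ _ _ rfl rfl h
    exact h
  -- every edge of `H` is followed by the same edge of `K` from all copies
  have follow : ∀ n m, R n m → ∀ e, H.source e = n → ∃ f, K.source f = m ∧ H.lab e = K.lab f ∧
      ∀ i j : Fin M, (i : ℕ) < c n → H.CopyEdge c e i j → Q (H.target e, j) (K.target f) := by
    intro n m hR e he
    have i0 : Fin M := ⟨0, by omega⟩
    have hedge : H.CopyEdge c e 0 0 := by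
      refine or_iff_not_imp_left.2 fun hs => ⟨rfl, fun ho => ?_⟩
      have := c2 _ (hH.opt_closed _ ⟨e, rfl, ho⟩)
      omega
    obtain ⟨w, w1, w2, -⟩ := hQ _ _ (hR ⟨0, by omega⟩ (cpos n))
    let g : G.Out (n, ⟨0, by omega⟩) := ⟨⟨(e, ⟨0, by omega⟩, ⟨0, by omega⟩), hedge⟩, by
      simp [G, copyGraph, he]⟩
    refine ⟨(w g).1, (w g).2, w1 g, fun i j hi hij => ?_⟩
    obtain ⟨v, v1, v2, -⟩ := hQ _ _ (hR i hi)
    let g' : G.Out (n, i) := ⟨⟨(e, i, j), hij⟩, by simp [G, copyGraph, he]⟩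
    have : (v g').1 = (w g).1 := hK.deterministic _ _ ((v g').2.trans (w g).2.symm)
      ((v1 g').symm.trans (w1 g))
    rw [← this]
    exact v2 g'
  have hidx : ∀ e, ∀ j : Fin M, (j : ℕ) < c (H.target e) →
      ∃ i : Fin M, (i : ℕ) < c (H.source e) ∧ H.CopyEdge c e i j := by
    intro e j hj
    by_cases hs : H.occur e = BasicInterval.star.toInterval
    · exact ⟨⟨0, by omega⟩, cpos _, Or.inl hs⟩
    · have hlt : (j : ℕ) < c (H.source e) ∧
          (H.occur e = BasicInterval.opt.toInterval → (j : ℕ) + 1 < c (H.source e)) := by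
        by_cases ht : H.NodeClosed (H.target e)
        · have := hrigid e hs ht
          exact ⟨by omega, fun _ => by omega⟩
        · rw [c1 _ ht] at hj
          have := cpos (H.source e)
          refine ⟨by omega, fun ho => ?_⟩
          have := c2 _ (hH.opt_closed _ ⟨e, rfl, ho⟩)
          omega
      exact ⟨j, hlt.1, Or.inr ⟨rfl, hlt.2⟩⟩
  have dom : ∀ e, H.StarClosed e → ∃ m, R (H.target e) m := by
    intro e he
    induction he with
    | star e he =>
      obtain ⟨m, hm⟩ := hQd (H.source e, (⟨0, by omega⟩ : Fin M))
      obtain ⟨w, w1, w2, -⟩ := hQ _ _ hm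
      have mk : ∀ j : Fin M, ∃ g : G.Out (H.source e, (⟨0, by omega⟩ : Fin M)),
          g.1.1 = (e, ⟨0, by omega⟩, j) := fun j =>
        ⟨⟨⟨(e, ⟨0, by omega⟩, j), Or.inl he⟩, rfl⟩, rfl⟩
      choose g hg using mk
      refine ⟨K.target (w (g ⟨0, by omega⟩)).1, fun j _ => ?_⟩
      have hlab : ∀ j, G.lab (g j).1 = H.lab e := fun j => by
        change H.lab (g j).1.1.1 = _
        rw [hg]
      have heq : (w (g ⟨0, by omega⟩)).1 = (w (g j)).1 := by
        refine hK.deterministic _ _ ((w _).2.trans (w _).2.symm) ?_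
        rw [← w1, ← w1, hlab, hlab]
      rw [heq]
      have := w2 (g j)
      have ht : G.target (g j).1 = (H.target e, j) := by
        change (H.target (g j).1.1.1, (g j).1.1.2.2) = _
        rw [hg]
      rwa [ht] at this
    | step e hne hall ih =>
      obtain ⟨e', he'⟩ := hne
      obtain ⟨m, hm⟩ := ih e' he'
      rw [he'] at hm
      obtain ⟨f, -, -, hf⟩ := follow _ _ hm e rfl
      refine ⟨K.target f, fun j hj => ?_⟩
      obtain ⟨i, hi, hij⟩ := hidx e j hj
      exact hf i j hi hij
  refine ⟨R, (isSimulation_iff_of_deterministic hH.deterministic hK.deterministic R).2 ?_, ?_⟩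
  · intro n m hR
    have hzero : ∀ f (i : Fin M), K.source f = m → (i : ℕ) < c n →
        (∀ e j, H.source e = n → H.lab e = K.lab f → ¬ H.CopyEdge c e i j) →
          0 ∈ (K.occur f).toSet := by
      intro f i hf hi hno
      obtain ⟨w, w1, -, w3⟩ := hQ _ _ (hR i hi)
      have := w3 ⟨f, hf⟩
      rwa [Finset.filter_false_of_mem, OccInterval.sum_empty_toSet_subset_iff] at this
      intro g _ hg
      have hs : (H.source g.1.1.1, g.1.1.2.1) = (n, i) := g.2
      have hl : H.lab g.1.1.1 = K.lab f := (w1 g).trans (by rw [hg])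
      simp only [Prod.mk.injEq] at hs
      exact hno g.1.1.1 g.1.1.2.2 hs.1 hl (copy_congr rfl hs.2 g.1.2)
    refine ⟨fun e he => ?_, fun f hf => ?_⟩
    · obtain ⟨f, hf, hl, hfol⟩ := follow n m hR e he
      refine ⟨f, hf, hl, fun j hj => ?_, ?_⟩
      · obtain ⟨i, hi, hij⟩ := hidx e j hj
        exact hfol i j (he ▸ hi) hij
      · have hmem : ∀ (i : Fin M) (s : Finset (Fin M)), (i : ℕ) < c n →
            (∀ j, j ∈ s ↔ H.CopyEdge c e i j) → s.card ∈ (K.occur f).toSet := by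
          intro i s hi hs
          obtain ⟨w, w1, -, w3⟩ := hQ _ _ (hR i hi)
          refine w3 ⟨f, hf⟩ ?_
          have hcard : (Finset.univ.filter fun g : G.Out (n, i) => w g = ⟨f, hf⟩).card =
              s.card := by
            refine Finset.card_bij (fun g _ => g.1.1.2.2) ?_ ?_ ?_
            · intro g hg
              simp only [Finset.mem_filter, Finset.mem_univ, true_and] at hg
              have hsg : (H.source g.1.1.1, g.1.1.2.1) = (n, i) := g.2
              simp only [Prod.mk.injEq] at hsg
              have hge : g.1.1.1 = e := hH.deterministic _ _ (hsg.1.trans he.symm)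
                ((w1 g).trans (by rw [hg, hl]))
              exact (hs _).2 (copy_congr hge hsg.2 g.1.2)
            · intro g hg g' hg' h
              simp only [Finset.mem_filter, Finset.mem_univ, true_and] at hg hg'
              have hsg : (H.source g.1.1.1, g.1.1.2.1) = (n, i) := g.2
              have hsg' : (H.source g'.1.1.1, g'.1.1.2.1) = (n, i) := g'.2
              simp only [Prod.mk.injEq] at hsg hsg'
              have hge : g.1.1.1 = g'.1.1.1 := hH.deterministic _ _ (hsg.1.trans hsg'.1.symm)
                ((w1 g).trans ((by rw [hg, hg'] : _ = _).trans (w1 g').symm))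
              exact Subtype.ext (Subtype.ext (Prod.ext hge
                (Prod.ext (hsg.2.trans hsg'.2.symm) h)))
            · intro j hj
              have hsrc : G.source ⟨(e, i, j), (hs j).1 hj⟩ = (n, i) := by
                simp [G, copyGraph, he]
              refine ⟨⟨⟨(e, i, j), (hs j).1 hj⟩, hsrc⟩, ?_, rfl⟩
              simp only [Finset.mem_filter, Finset.mem_univ, true_and]
              refine Subtype.ext (hK.deterministic _ _ ((w _).2.trans hf.symm) ?_)
              rw [← w1, ← hl]
              rfl
          have hlo : ∑ g with w g = ⟨f, hf⟩, (G.occur g.1).lo = s.card :=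
            (Finset.card_eq_sum_ones _).symm.trans hcard
          have hhi : ∑ g with w g = ⟨f, hf⟩, (G.occur g.1).hi = s.card :=
            (Finset.sum_const (1 : ℕ∞)).trans (by rw [nsmul_one, hcard])
          exact ⟨hlo.le, hhi.ge⟩
        have h01 : H.occur e ≠ BasicInterval.star.toInterval → 1 ∈ (K.occur f).toSet := by
          intro hs
          have := hmem ⟨0, by omega⟩ {⟨0, by omega⟩} (cpos n) fun j => by
            rw [CopyEdge, or_iff_right hs, Finset.mem_singleton, Fin.ext_iff]
            refine ⟨fun h => ⟨h.symm, fun ho => ?_⟩, fun h => h.1.symm⟩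
            have := c2 _ (hH.opt_closed _ ⟨e, rfl, ho⟩)
            simp only
            omega
          simpa using this
        obtain ⟨B, hB⟩ := hH.shape e
        cases B with
        | one =>
          have h1 := h01 (by
            rw [hB]
            exact fun h => absurd (BasicInterval.toInterval_injective h) (by decide))
          rw [hB, OccInterval.toSet_subset_iff]
          exact ⟨h1.1, by simpa [BasicInterval.toInterval] using h1.2⟩
        | opt =>
          have hns : H.occur e ≠ BasicInterval.star.toInterval := by
            rw [hB]
            exact fun h => absurd (BasicInterval.toInterval_injective h) (by decide)
          have h1 := h01 hns
          have h2 := c2 _ (hH.opt_closed _ ⟨e, rfl, hB⟩)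
          rw [he] at h2
          have hM := hcM n
          have h0 : 0 ∈ (K.occur f).toSet := by
            refine hzero f ⟨c n - 1, by omega⟩ hf (by simp only; omega) fun e' j he' hl' hc => ?_
            obtain rfl := hH.deterministic _ _ (he'.trans he.symm) (hl'.trans hl.symm)
            have := (hc.resolve_left hns).2 hB
            rw [he] at this
            simp only at this
            omega
          rw [hB, OccInterval.toSet_subset_iff]
          exact ⟨h0.1, by simpa [BasicInterval.toInterval] using h1.2⟩
        | plus => exact absurd hB (hH.no_plus e)
        | star =>
          have := hmem ⟨0, by omega⟩ Finset.univ (cpos n) fun j => by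
            simp [CopyEdge, hB]
          rw [Finset.card_fin] at this
          rw [hB, eq_star_of_mem hK.shape hK.no_plus f hM2 this]
    · refine or_iff_not_imp_right.2 fun hno => ?_
      exact hzero f ⟨0, by omega⟩ hf (cpos n) fun e j he hl _ => hno ⟨e, he, hl⟩
  · intro n
    by_cases hn : H.NodeClosed n
    · obtain ⟨⟨e, rfl⟩, hall⟩ := hn
      exact dom e (hall e rfl)
    · obtain ⟨m, hm⟩ := hQd (n, ⟨0, by omega⟩)
      refine ⟨m, fun i hi => ?_⟩
      rw [c1 n hn] at hi
      have : i = ⟨0, by omega⟩ := Fin.ext (by simp only; omega)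
      rwa [this]

end LGraph

/-! ### A while language for machines with several stacks -/

namespace StackProg

/-- The working stacks. -/
inductive Tape where
  | a
  | b
  | c
  | d
  | e
  deriving DecidableEq

instance : Fintype Tape where
  elems := {.a, .b, .c, .d, .e}
  complete := by intro x; cases x <;> decide

/-- The finite control store. -/
structure Ctl where
  x : Option Bool
  y : Option Bool
  flag : Bool
  sym : Option GSymbol
  deriving DecidableEq, Fintype

/-- The control store at the beginning. -/
def Ctl.start : Ctl := ⟨none, none, false, none⟩

/-- The memory: the control store, the working stacks and the rest of the input. -/
@[ext]
structure Mem where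
  v : Ctl
  stk : Tape → List Bool
  inp : List GSymbol

/-- Instructions without control flow. -/
inductive Instr where
  | push (k : Tape) (f : Ctl → Bool)
  | pop (k : Tape) (f : Ctl → Option Bool → Ctl)
  | read (f : Ctl → Option GSymbol → Ctl)
  | load (f : Ctl → Ctl)

/-- The effect of an instruction. -/
def Instr.eval : Instr → Mem → Mem
  | .push k f, m => ⟨m.v, Function.update m.stk k (f m.v :: m.stk k), m.inp⟩
  | .pop k f, m => ⟨f m.v (m.stk k).head?, Function.update m.stk k (m.stk k).tail, m.inp⟩
  | .read f, m => ⟨f m.v m.inp.head?, m.stk, m.inp.tail⟩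
  | .load f, m => ⟨f m.v, m.stk, m.inp⟩

/-- Programs. -/
inductive Cmd where
  | basic (l : List Instr)
  | seq (p q : Cmd)
  | ite (t : Ctl → Bool) (p q : Cmd)
  | loop (t : Ctl → Bool) (p : Cmd)

/-- `Exec p m m' n`: the program `p` leads from `m` to `m'` in `n` steps. -/
inductive Exec : Cmd → Mem → Mem → ℕ → Prop where
  | basic (l m) : Exec (.basic l) m (l.foldl (fun m i => i.eval m) m) 1
  | seq {p q m₁ m₂ m₃ n₁ n₂} (h₁ : Exec p m₁ m₂ n₁) (h₂ : Exec q m₂ m₃ n₂) :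
      Exec (.seq p q) m₁ m₃ (n₁ + n₂)
  | ite_true {t p q m m' n} (ht : t m.v = true) (h : Exec p m m' n) : Exec (.ite t p q) m m' (1 + n)
  | ite_false {t p q m m' n} (ht : t m.v = false) (h : Exec q m m' n) :
      Exec (.ite t p q) m m' (1 + n)
  | loop_true {t p m₁ m₂ m₃ n₁ n₂} (ht : t m₁.v = true) (h₁ : Exec p m₁ m₂ n₁)
      (h₂ : Exec (.loop t p) m₂ m₃ n₂) : Exec (.loop t p) m₁ m₃ (1 + n₁ + n₂)
  | loop_false {t p m} (ht : t m.v = false) : Exec (.loop t p) m m 1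

/-! ### Compilation to stack Turing machines -/

/-- The labels of the compiled program. -/
def Lbl : Cmd → Type
  | .basic _ => Unit
  | .seq p q => Lbl p ⊕ Lbl q
  | .ite _ p q => Option (Lbl p ⊕ Lbl q)
  | .loop _ p => Option (Lbl p)

/-- There are finitely many labels. -/
@[reducible]
def lblFintype : (p : Cmd) → Fintype (Lbl p)
  | .basic _ => inferInstanceAs (Fintype Unit)
  | .seq p q =>
    letI := lblFintype p
    letI := lblFintype q
    inferInstanceAs (Fintype (Lbl p ⊕ Lbl q))
  | .ite _ p q =>
    letI := lblFintype p
    letI := lblFintype q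
    inferInstanceAs (Fintype (Option (Lbl p ⊕ Lbl q)))
  | .loop _ p =>
    letI := lblFintype p
    inferInstanceAs (Fintype (Option (Lbl p)))

/-- The label at which the compiled program starts. -/
def entry : (p : Cmd) → Lbl p
  | .basic _ => ()
  | .seq p _ => Sum.inl (entry p)
  | .ite _ _ _ => none
  | .loop _ _ => none

/-- The alphabets of the stacks: `none` is the input stack. -/
abbrev Alphabet : Option Tape → Type
  | none => GSymbol
  | some _ => Bool

/-- Compilation of an instruction. -/
def Instr.toStmt {Λ : Type} : Instr → Turing.TM2.Stmt Alphabet Λ Ctl →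
    Turing.TM2.Stmt Alphabet Λ Ctl
  | .push k f, q => .push (some k) f q
  | .pop k f, q => .pop (some k) f q
  | .read f, q => .pop none f q
  | .load f, q => .load f q

/-- Compilation of a program whose labels are embedded by `emb` and which leaves to `exit`. -/
def compile {Λ : Type} : (p : Cmd) → (exit : Λ) → (emb : Lbl p → Λ) → Lbl p →
    Turing.TM2.Stmt Alphabet Λ Ctl
  | .basic l, exit, _, _ => l.foldr Instr.toStmt (.goto fun _ => exit)
  | .seq p q, _, emb, Sum.inl i => compile p (emb (Sum.inr (entry q))) (fun j => emb (Sum.inl j)) i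
  | .seq _ q, exit, emb, Sum.inr i => compile q exit (fun j => emb (Sum.inr j)) i
  | .ite t p q, _, emb, none =>
    .branch t (.goto fun _ => emb (some (Sum.inl (entry p))))
      (.goto fun _ => emb (some (Sum.inr (entry q))))
  | .ite _ p _, exit, emb, some (Sum.inl i) => compile p exit (fun j => emb (some (Sum.inl j))) i
  | .ite _ _ q, exit, emb, some (Sum.inr i) => compile q exit (fun j => emb (some (Sum.inr j))) i
  | .loop t p, exit, emb, none =>
    .branch t (.goto fun _ => emb (some (entry p))) (.goto fun _ => exit)
  | .loop _ p, _, emb, some i => compile p (emb none) (fun j => emb (some j)) i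

/-- The stacks of the machine. -/
def Mem.stacks (m : Mem) : ∀ k, List (Alphabet k)
  | none => m.inp
  | some k => m.stk k

/-- The configuration of the machine. -/
def Mem.cfg {Λ : Type} (m : Mem) (l : Option Λ) : Turing.TM2.Cfg Alphabet Λ Ctl :=
  ⟨l, m.v, m.stacks⟩

theorem update_stacks_some (m : Mem) (k : Tape) (l : List Bool) (v : Ctl) :
    Function.update m.stacks (some k) l = Mem.stacks ⟨v, Function.update m.stk k l, m.inp⟩ := by
  funext j
  cases j with
  | none => simp [Mem.stacks]
  | some j =>
    by_cases h : j = k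
    · subst h
      simp [Mem.stacks]
    · rw [Function.update_of_ne (by simpa using h)]
      simp [Mem.stacks, h]

theorem update_stacks_none (m : Mem) (l : List GSymbol) (v : Ctl) :
    Function.update m.stacks none l = Mem.stacks ⟨v, m.stk, l⟩ := by
  funext j
  cases j with
  | none => simp [Mem.stacks]
  | some j => simp [Mem.stacks]

theorem stepAux_toStmt {Λ : Type} (i : Instr) (q : Turing.TM2.Stmt Alphabet Λ Ctl) (m : Mem) :
    Turing.TM2.stepAux (i.toStmt q) m.v m.stacks =
      Turing.TM2.stepAux q (i.eval m).v (i.eval m).stacks := by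
  cases i with
  | push k f =>
    simp only [Instr.toStmt, Instr.eval, Turing.TM2.stepAux]
    rw [update_stacks_some m k _ m.v]
    rfl
  | pop k f =>
    simp only [Instr.toStmt, Instr.eval, Turing.TM2.stepAux]
    rw [update_stacks_some m k _ (f m.v (m.stk k).head?)]
    rfl
  | read f =>
    simp only [Instr.toStmt, Instr.eval, Turing.TM2.stepAux]
    rw [update_stacks_none m _ (f m.v m.inp.head?)]
    rfl
  | load f => rfl

theorem stepAux_basic {Λ : Type} (l : List Instr) (exit : Λ) (m : Mem) :
    Turing.TM2.stepAux (l.foldr Instr.toStmt (.goto fun _ => exit)) m.v m.stacks =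
      (l.foldl (fun m i => i.eval m) m).cfg (some exit) := by
  induction l generalizing m with
  | nil => rfl
  | cons i l ih => rw [List.foldr_cons, List.foldl_cons, stepAux_toStmt, ih]

/-- `Steps f n s s'`: iterating the partial step function `f` leads from `s` to `s'` in `n` steps. -/
def Steps {α : Type} (f : α → Option α) (n : ℕ) (s s' : α) : Prop :=
  (flip bind f)^[n] (some s) = some s'

theorem Steps.trans {α : Type} {f : α → Option α} {n₁ n₂ : ℕ} {s₁ s₂ s₃ : α}
    (h₁ : Steps f n₁ s₁ s₂) (h₂ : Steps f n₂ s₂ s₃) : Steps f (n₁ + n₂) s₁ s₃ := by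
  unfold Steps at *
  rw [Nat.add_comm, Function.iterate_add_apply, h₁, h₂]

theorem Steps.one {α : Type} {f : α → Option α} {s s' : α} (h : f s = some s') :
    Steps f 1 s s' := h

theorem Exec.steps {Λ : Type} (M : Λ → Turing.TM2.Stmt Alphabet Λ Ctl) {p : Cmd} {m m' : Mem}
    {n : ℕ} (h : Exec p m m' n) : ∀ (exit : Λ) (emb : Lbl p → Λ),
      (∀ i, M (emb i) = compile p exit emb i) →
      Steps (Turing.TM2.step M) n (m.cfg (some (emb (entry p)))) (m'.cfg (some exit)) := by
  induction h with
  | basic l m =>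
    intro exit emb hM
    refine Steps.one ?_
    change some (Turing.TM2.stepAux (M (emb (entry (.basic l)))) m.v m.stacks) = _
    rw [hM]
    exact congrArg some (stepAux_basic l exit m)
  | seq _ _ ih₁ ih₂ =>
    intro exit emb hM
    exact (ih₁ _ (fun j => emb (Sum.inl j)) fun i => hM (Sum.inl i)).trans
      (ih₂ exit (fun j => emb (Sum.inr j)) fun i => hM (Sum.inr i))
  | @ite_true t p q m m' n ht _ ih =>
    intro exit emb hM
    refine Steps.trans (Steps.one ?_)
      (ih exit (fun j => emb (some (Sum.inl j))) fun i => hM (some (Sum.inl i)))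
    change some (Turing.TM2.stepAux (M (emb (entry (.ite t p q)))) m.v m.stacks) = _
    rw [hM]
    simp [compile, entry, ht, Mem.cfg]
  | @ite_false t p q m m' n ht _ ih =>
    intro exit emb hM
    refine Steps.trans (Steps.one ?_)
      (ih exit (fun j => emb (some (Sum.inr j))) fun i => hM (some (Sum.inr i)))
    change some (Turing.TM2.stepAux (M (emb (entry (.ite t p q)))) m.v m.stacks) = _
    rw [hM]
    simp [compile, entry, ht, Mem.cfg]
  | @loop_true t p m₁ m₂ m₃ n₁ n₂ ht _ _ ih₁ ih₂ =>
    intro exit emb hM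
    refine Steps.trans (Steps.trans (Steps.one ?_)
      (ih₁ (emb none) (fun j => emb (some j)) fun i => hM (some i))) (ih₂ exit emb hM)
    change some (Turing.TM2.stepAux (M (emb (entry (.loop t p)))) m₁.v m₁.stacks) = _
    rw [hM]
    simp [compile, entry, ht, Mem.cfg]
  | @loop_false t p m ht =>
    intro exit emb hM
    refine Steps.one ?_
    change some (Turing.TM2.stepAux (M (emb (entry (.loop t p)))) m.v m.stacks) = _
    rw [hM]
    simp [compile, entry, ht, Mem.cfg]

/-- The machine that runs a program, starting with its input on the input stack, and halts with its
output on the stack `b`. -/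
def machine (p : Cmd) : Turing.FinTM2 :=
  letI := lblFintype p
  { K := Option Tape
    k₀ := none
    k₁ := some .b
    Γ := Alphabet
    Λ := Option (Lbl p)
    main := some (entry p)
    σ := Ctl
    initialState := Ctl.start
    Γk₀Fin := inferInstanceAs (Fintype GSymbol)
    m := fun l => l.elim .halt (compile p none some) }

/-- The memory with a given input and empty working stacks. -/
def inputMem (w : List GSymbol) : Mem := ⟨Ctl.start, fun _ => [], w⟩

/-- The memory with a given output on the stack `b` and all other stacks empty. -/
def outputMem (o : List Bool) : Mem := ⟨Ctl.start, Function.update (fun _ => []) .b o, []⟩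

/-- A program that computes the output bit `f w` in polynomial time gives a machine. -/
theorem nonempty_polyTime {f : List GSymbol → Bool} (p : Cmd) (T : Polynomial ℕ)
    (h : ∀ w, ∃ n ≤ T.eval w.length, Exec p (inputMem w) (outputMem [f w]) n) :
    Nonempty (Turing.TM2ComputableInPolyTime (id : List GSymbol → List GSymbol)
      Computability.encodeBool f) := by
  choose n hn he using h
  refine ⟨⟨⟨machine p, Equiv.refl _, Equiv.refl _⟩, T + 1, fun w => ⟨⟨n w + 1, ?_⟩, ?_⟩⟩⟩
  · have h1 := (he w).steps (machine p).m none some fun i => rfl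
    have h2 : Steps (machine p).step 1 ((outputMem [f w]).cfg (some none))
        ((outputMem [f w]).cfg none) := rfl
    have h3 := h1.trans h2
    have e1 : Turing.initList (machine p) (List.map (Equiv.refl GSymbol).invFun w) =
        (inputMem w).cfg (some (some (entry p))) := by
      refine congrArg₂ (Turing.TM2.Cfg.mk _) rfl (funext fun k => ?_)
      cases k with
      | none => exact List.map_id w
      | some k => rfl
    have e2 : Turing.haltList (machine p) (List.map (Equiv.refl Bool).invFun [f w]) =
        (outputMem [f w]).cfg none := by
      refine congrArg₂ (Turing.TM2.Cfg.mk _) rfl (funext fun k => ?_)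
      cases k with
      | none => rfl
      | some k => cases k <;> rfl
    exact (congrArg (fun c => (flip bind (machine p).step)^[n w + 1] (some c)) e1).trans
      (Eq.trans h3 (congrArg some e2).symm)
  · simpa using hn w

/-! ### Running time bounds -/

/-- `Runs p m m' T`: the program `p` leads from `m` to `m'` in at most `T` steps. -/
def Runs (p : Cmd) (m m' : Mem) (T : ℕ) : Prop := ∃ n ≤ T, Exec p m m' n

theorem Runs.basic {l : List Instr} {m m' : Mem} {T : ℕ}
    (h : l.foldl (fun m i => i.eval m) m = m') (hT : 1 ≤ T) : Runs (.basic l) m m' T :=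
  ⟨1, hT, h ▸ .basic l m⟩

theorem Runs.seq {p q : Cmd} {m₁ m₂ m₃ : Mem} {T₁ T₂ T : ℕ} (h₁ : Runs p m₁ m₂ T₁)
    (h₂ : Runs q m₂ m₃ T₂) (hT : T₁ + T₂ ≤ T) : Runs (.seq p q) m₁ m₃ T := by
  obtain ⟨n₁, l₁, e₁⟩ := h₁
  obtain ⟨n₂, l₂, e₂⟩ := h₂
  exact ⟨_, by omega, e₁.seq e₂⟩

theorem Runs.ite_true {t : Ctl → Bool} {p q : Cmd} {m m' : Mem} {T T' : ℕ} (ht : t m.v = true)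
    (h : Runs p m m' T') (hT : 1 + T' ≤ T) : Runs (.ite t p q) m m' T := by
  obtain ⟨n, l, e⟩ := h
  exact ⟨_, by omega, e.ite_true ht⟩

theorem Runs.ite_false {t : Ctl → Bool} {p q : Cmd} {m m' : Mem} {T T' : ℕ} (ht : t m.v = false)
    (h : Runs q m m' T') (hT : 1 + T' ≤ T) : Runs (.ite t p q) m m' T := by
  obtain ⟨n, l, e⟩ := h
  exact ⟨_, by omega, e.ite_false ht⟩

theorem Runs.loop_true {t : Ctl → Bool} {p : Cmd} {m₁ m₂ m₃ : Mem} {T₁ T₂ T : ℕ}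
    (ht : t m₁.v = true) (h₁ : Runs p m₁ m₂ T₁) (h₂ : Runs (.loop t p) m₂ m₃ T₂)
    (hT : 1 + T₁ + T₂ ≤ T) : Runs (.loop t p) m₁ m₃ T := by
  obtain ⟨n₁, l₁, e₁⟩ := h₁
  obtain ⟨n₂, l₂, e₂⟩ := h₂
  exact ⟨_, by omega, .loop_true ht e₁ e₂⟩

theorem Runs.loop_false {t : Ctl → Bool} {p : Cmd} {m : Mem} {T : ℕ} (ht : t m.v = false)
    (hT : 1 ≤ T) : Runs (.loop t p) m m T :=
  ⟨1, hT, .loop_false ht⟩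

theorem Runs.mono {p : Cmd} {m m' : Mem} {T T' : ℕ} (h : Runs p m m' T) (hT : T ≤ T') :
    Runs p m m' T' := by
  obtain ⟨n, l, e⟩ := h
  exact ⟨n, l.trans hT, e⟩

theorem Runs.seq_loop_true {t : Ctl → Bool} {p q : Cmd} {m₁ m₂ m₃ : Mem} {T₁ T₂ T : ℕ}
    (ht : t m₁.v = true) (h₁ : Runs p m₁ m₂ T₁) (h₂ : Runs (.seq (.loop t p) q) m₂ m₃ T₂)
    (hT : 1 + T₁ + T₂ ≤ T) : Runs (.seq (.loop t p) q) m₁ m₃ T := by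
  obtain ⟨n₁, l₁, e₁⟩ := h₁
  obtain ⟨n₂, l₂, e₂⟩ := h₂
  cases e₂ with
  | seq e₃ e₄ => exact ⟨_, by omega, (Exec.loop_true ht e₁ e₃).seq e₄⟩

theorem Runs.congr_left {p : Cmd} {m₁ m₂ m' : Mem} {T : ℕ} (h : Runs p m₁ m' T) (e : m₂ = m₁) :
    Runs p m₂ m' T := e ▸ h

theorem Runs.congr_right {p : Cmd} {m m₁ m₂ : Mem} {T : ℕ} (h : Runs p m m₁ T) (e : m₁ = m₂) :
    Runs p m m₂ T := e ▸ h

/-! ### Binary trees on a stack -/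

/-- Binary trees. -/
inductive Bin where
  | nil
  | node (l r : Bin)
  deriving DecidableEq

/-- The preorder code of a tree. -/
def Bin.code : Bin → List Bool
  | nil => [false]
  | node l r => true :: (l.code ++ r.code)

/-- The length of the code of a tree. -/
def Bin.size (t : Bin) : ℕ := t.code.length

@[simp] theorem Bin.size_nil : Bin.nil.size = 1 := rfl

@[simp] theorem Bin.size_node (l r : Bin) : (Bin.node l r).size = l.size + r.size + 1 := by
  simp [Bin.size, Bin.code]

theorem Bin.code_append_inj (s t : Bin) : ∀ {q r : List Bool}, s.code ++ q = t.code ++ r →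
    s = t ∧ q = r := by
  induction s generalizing t with
  | nil =>
    intro q r h
    cases t with
    | nil => simpa [code] using h
    | node l' r' => simp [code] at h
  | node l₁ r₁ ih₁ ih₂ =>
    intro q r h
    cases t with
    | nil => simp [code] at h
    | node l' r' =>
      simp only [code, List.cons_append, List.append_assoc, List.cons.injEq, true_and] at h
      obtain ⟨rfl, h'⟩ := ih₁ _ h
      obtain ⟨rfl, h''⟩ := ih₂ _ h'
      exact ⟨rfl, h''⟩

theorem Bin.code_injective : Function.Injective Bin.code := fun s t h =>
  (s.code_append_inj t (q := []) (r := []) (by simpa using h)).1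

/-- The working stacks with given contents. -/
def tapes (a b c d e : List Bool) : Tape → List Bool
  | .a => a
  | .b => b
  | .c => c
  | .d => d
  | .e => e

section tapes

variable (a b c d e l : List Bool)

@[simp] theorem tapes_a : tapes a b c d e .a = a := rfl
@[simp] theorem tapes_b : tapes a b c d e .b = b := rfl
@[simp] theorem tapes_c : tapes a b c d e .c = c := rfl
@[simp] theorem tapes_d : tapes a b c d e .d = d := rfl
@[simp] theorem tapes_e : tapes a b c d e .e = e := rfl

@[simp] theorem update_tapes_a : Function.update (tapes a b c d e) .a l = tapes l b c d e := by
  funext k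
  cases k <;> rfl

@[simp] theorem update_tapes_b : Function.update (tapes a b c d e) .b l = tapes a l c d e := by
  funext k
  cases k <;> rfl

@[simp] theorem update_tapes_c : Function.update (tapes a b c d e) .c l = tapes a b l d e := by
  funext k
  cases k <;> rfl

@[simp] theorem update_tapes_d : Function.update (tapes a b c d e) .d l = tapes a b c l e := by
  funext k
  cases k <;> rfl

@[simp] theorem update_tapes_e : Function.update (tapes a b c d e) .e l = tapes a b c d l := by
  funext k
  cases k <;> rfl

end tapes

/-- The memory in which only the stack `a` is in use. -/
def mem (r : List Bool) : Mem := ⟨Ctl.start, tapes r [] [] [] [], []⟩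

/-! ### Moving things between stacks -/

/-- Clear the control store. -/
def reset : Instr := .load fun _ => Ctl.start

/-- Pop into the first register. -/
def popX (k : Tape) : Instr := .pop k fun v o => { v with x := o }

/-- Pop into the second register. -/
def popY (k : Tape) : Instr := .pop k fun v o => { v with y := o }

/-- Push a constant. -/
def pushC (k : Tape) (z : Bool) : Instr := .push k fun _ => z

/-- Push the second register. -/
def pushY (k : Tape) : Instr := .push k fun v => v.y.getD false

/-- Move a tree, while the unary counter on the stack `c` shows how many subtrees are open. -/
def mvLoop (k : Tape) : Cmd :=
  .loop (fun v => v.x.isSome) <|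
    .seq (.basic [popY .a, pushY k]) <|
      .seq (.ite (fun v => v.y = some true) (.basic [pushC .c true, pushC .c true]) (.basic [])) <|
        .basic [popX .c]

/-- Move the top tree of the stack `a` to the stack `k`, with its code reversed. -/
def mv (k : Tape) : Cmd :=
  .seq (.basic [.load fun v => { v with x := some true }]) (.seq (mvLoop k) (.basic [reset]))

theorem mvLoop_runs {k : Tape} (hk : k = .b ∨ k = .d ∨ k = .e) (q : Cmd) (t : Bin) :
    ∀ (N : ℕ) (v : Ctl) (s : Tape → List Bool) (i : List GSymbol) (r : List Bool) (m' : Mem)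
      (T : ℕ), v.x = some true → s .a = t.code ++ r → s .c = List.replicate N true →
      (∀ v' : Ctl, v'.x = (List.replicate N true).head? → Runs (.seq (mvLoop k) q)
        ⟨v', Function.update (Function.update (Function.update s .a r) .c
          (List.replicate N true).tail) k (t.code.reverse ++ s k), i⟩ m' T) →
      Runs (.seq (mvLoop k) q) ⟨v, s, i⟩ m' (5 * t.size + T) := by
  induction t with
  | nil =>
    intro N v s i r m' T hv ha hc h
    refine Runs.seq_loop_true (by simp [hv]) (.seq (.basic rfl le_rfl)
      (.seq (.ite_false ?_ (.basic rfl le_rfl) le_rfl) (.basic rfl le_rfl) le_rfl) le_rfl)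
      (T₂ := T) ?_ ?_
    · simp [popY, pushY, Instr.eval, ha, Bin.code]
    · refine (h ⟨(List.replicate N true).head?, some false, v.flag, v.sym⟩ rfl).congr_left
        (Mem.ext ?_ (funext fun j => ?_) ?_)
      · rcases hk with rfl | rfl | rfl <;>
          simp [popY, pushY, popX, Instr.eval, ha, hc, Bin.code]
      · rcases hk with rfl | rfl | rfl <;> cases j <;>
          simp [popY, pushY, popX, Instr.eval, ha, hc, Bin.code]
      · rfl
    · simp only [Bin.size_nil]
      omega
  | node l t ihl iht =>
    intro N v s i r m' T hv ha hc h
    refine Runs.seq_loop_true (by simp [hv]) (.seq (.basic rfl le_rfl)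
      (.seq (.ite_true ?_ (.basic rfl le_rfl) le_rfl) (.basic rfl le_rfl) le_rfl) le_rfl)
      (T₂ := 5 * l.size + (5 * t.size + T)) ?_ ?_
    · simp [popY, pushY, Instr.eval, ha, Bin.code]
    · refine ihl (N + 1) _ _ _ (t.code ++ r) _ _ ?_ ?_ ?_ ?_
      · rcases hk with rfl | rfl | rfl <;>
          simp [popY, pushY, pushC, Instr.eval]
      · rcases hk with rfl | rfl | rfl <;>
          simp [popY, pushY, pushC, Instr.eval, ha, Bin.code]
      · rcases hk with rfl | rfl | rfl <;>
          simp [popY, pushY, pushC, Instr.eval, hc, List.replicate_succ]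
      · intro v' hv'
        refine iht N _ _ _ r _ _ (by simpa [List.replicate_succ] using hv') ?_ ?_ ?_
        · rcases hk with rfl | rfl | rfl <;> simp
        · rcases hk with rfl | rfl | rfl <;> simp [List.replicate_succ]
        · intro v'' hv''
          refine (h v'' hv'').congr_left (Mem.ext rfl (funext fun j => ?_) rfl)
          rcases hk with rfl | rfl | rfl <;> cases j <;>
            simp [popY, pushY, pushC, Instr.eval, ha, Bin.code]
    · simp only [Bin.size_node]
      omega

theorem mv_runs {k : Tape} (hk : k = .b ∨ k = .d ∨ k = .e) (t : Bin) {s : Tape → List Bool}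
    {v : Ctl} {i : List GSymbol} {r : List Bool} (ha : s .a = t.code ++ r) (hc : s .c = []) :
    Runs (mv k) ⟨v, s, i⟩ ⟨Ctl.start, Function.update (Function.update s .a r) k
      (t.code.reverse ++ s k), i⟩ (5 * t.size + 3) := by
  refine .seq (.basic rfl le_rfl) (mvLoop_runs hk _ t 0 _ _ _ r _ 2 rfl ha hc fun v' hv' => ?_)
    (by omega)
  refine .seq (.loop_false (by simp [hv']) le_rfl) (.basic ?_ le_rfl) le_rfl
  refine Mem.ext rfl (funext fun j => ?_) rfl
  rcases hk with rfl | rfl | rfl <;> cases j <;> simp [reset, Instr.eval, hc]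

/-- Move the whole stack `k` to the stacks `l`, in reversed order. -/
def flush (k : Tape) (l : List Tape) : Cmd :=
  .seq (.basic [popY k]) (.seq (.loop (fun v => v.y.isSome) (.basic (l.map pushY ++ [popY k])))
    (.basic [reset]))

/-- The effect of `flush` on the stacks. -/
def flushed (k : Tape) (l : List Tape) (s : Tape → List Bool) : Tape → List Bool :=
  fun j => if j = k then [] else if j ∈ l then (s k).reverse ++ s j else s j

theorem foldl_pushY (l : List Tape) (hl : l.Nodup) (v : Ctl) (s : Tape → List Bool)
    (i : List GSymbol) : (l.map pushY).foldl (fun m i => i.eval m) ⟨v, s, i⟩ =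
      ⟨v, fun j => if j ∈ l then v.y.getD false :: s j else s j, i⟩ := by
  induction l generalizing s with
  | nil => simp
  | cons k l ih =>
    simp only [List.map_cons, List.foldl_cons, List.nodup_cons] at hl ⊢
    rw [show (pushY k).eval ⟨v, s, i⟩ = ⟨v, Function.update s k (v.y.getD false :: s k), i⟩ from rfl,
      ih hl.2]
    congr 1
    funext j
    by_cases hj : j = k
    · subst hj
      simp [hl.1]
    · simp [hj]

theorem flush_loop_runs (k : Tape) (l : List Tape) (hl : l.Nodup) (hk : k ∉ l) (w : List Bool) :
    ∀ (v : Ctl) (s : Tape → List Bool) (i : List GSymbol), w.head? = v.y → s k = w.tail →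
      ∃ v', Runs (.loop (fun v => v.y.isSome) (.basic (l.map pushY ++ [popY k]))) ⟨v, s, i⟩
        ⟨v', flushed k l (Function.update s k w), i⟩ (2 * w.length + 1) := by
  induction w with
  | nil =>
    intro v s i hv hs
    refine ⟨v, ?_⟩
    have : flushed k l (Function.update s k []) = s := by
      funext j
      by_cases hj : j = k
      · subst hj
        simpa [flushed] using hs.symm
      · simp [flushed, hj]
    rw [this]
    exact .loop_false (by simp [← hv]) le_rfl
  | cons z w ih =>
    intro v s i hv hs
    simp only [List.head?_cons, List.tail_cons] at hv hs
    obtain ⟨v', h⟩ := ih { v with y := w.head? }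
      (Function.update (fun j => if j ∈ l then z :: s j else s j) k w.tail) i rfl (by simp)
    refine ⟨v', .loop_true (m₂ := ⟨{ v with y := w.head? },
        Function.update (fun j => if j ∈ l then z :: s j else s j) k w.tail, i⟩)
      (by simp [← hv]) (.basic ?_ le_rfl) (T₂ := 2 * w.length + 1) ?_
      (by simp only [List.length_cons]; omega)⟩
    · rw [List.foldl_append, foldl_pushY l hl]
      simp only [popY, List.foldl_cons, List.foldl_nil, Instr.eval, hk, if_false, hs, ← hv,
        Option.getD_some]
    · refine h.congr_right (Mem.ext rfl (funext fun j => ?_) rfl)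
      by_cases hj : j = k
      · simp [flushed, hj]
      · by_cases hjl : j ∈ l <;> simp [flushed, hj, hjl]

theorem flush_runs (k : Tape) (l : List Tape) (hl : l.Nodup) (hk : k ∉ l) (v : Ctl)
    (s : Tape → List Bool) (i : List GSymbol) :
    Runs (flush k l) ⟨v, s, i⟩ ⟨Ctl.start, flushed k l s, i⟩ (2 * (s k).length + 3) := by
  obtain ⟨v', h⟩ := flush_loop_runs k l hl hk (s k) { v with y := (s k).head? }
    (Function.update s k (s k).tail) i rfl (by simp)
  refine .seq (.basic rfl le_rfl) (.seq h (.basic ?_ le_rfl) le_rfl) (by omega)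
  simp [reset, Instr.eval]

open Bin

/-! ### Operations on a stack of trees -/

theorem mv_b_runs (t : Bin) (r d e : List Bool) (v : Ctl) (i : List GSymbol) :
    Runs (mv .b) ⟨v, tapes (t.code ++ r) [] [] d e, i⟩
      ⟨Ctl.start, tapes r t.code.reverse [] d e, i⟩ (5 * t.size + 3) :=
  (mv_runs (by simp) t rfl rfl).congr_right (by simp)

theorem mv_d_runs (t : Bin) (r b e : List Bool) (v : Ctl) (i : List GSymbol) :
    Runs (mv .d) ⟨v, tapes (t.code ++ r) b [] [] e, i⟩
      ⟨Ctl.start, tapes r b [] t.code.reverse e, i⟩ (5 * t.size + 3) :=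
  (mv_runs (by simp) t rfl rfl).congr_right (by simp)

theorem mv_e_runs (t : Bin) (r b d : List Bool) (v : Ctl) (i : List GSymbol) :
    Runs (mv .e) ⟨v, tapes (t.code ++ r) b [] d [], i⟩
      ⟨Ctl.start, tapes r b [] d t.code.reverse, i⟩ (5 * t.size + 3) :=
  (mv_runs (by simp) t rfl rfl).congr_right (by simp)

theorem flush_runs_of_eq {k : Tape} {l : List Tape} {v : Ctl} {s s' : Tape → List Bool}
    {i : List GSymbol} {T : ℕ} (hl : l.Nodup) (hk : k ∉ l) (hs : ∀ j, flushed k l s j = s' j)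
    (hT : 2 * (s k).length + 3 ≤ T) : Runs (flush k l) ⟨v, s, i⟩ ⟨Ctl.start, s', i⟩ T := by
  obtain rfl : flushed k l s = s' := funext hs
  exact (flush_runs k l hl hk v s i).mono hT

theorem flush_b_runs (t : Bin) (r d e : List Bool) (v : Ctl) (i : List GSymbol) :
    Runs (flush .b [.a]) ⟨v, tapes r t.code.reverse [] d e, i⟩
      ⟨Ctl.start, tapes (t.code ++ r) [] [] d e, i⟩ (2 * t.size + 3) :=
  flush_runs_of_eq (by simp) (by simp) (fun j => by cases j <;> simp [flushed]) (by simp [size])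

theorem flush_d_runs (t : Bin) (r b e : List Bool) (v : Ctl) (i : List GSymbol) :
    Runs (flush .d [.a]) ⟨v, tapes r b [] t.code.reverse e, i⟩
      ⟨Ctl.start, tapes (t.code ++ r) b [] [] e, i⟩ (2 * t.size + 3) :=
  flush_runs_of_eq (by simp) (by simp) (fun j => by cases j <;> simp [flushed]) (by simp [size])

theorem flush_e_runs (t : Bin) (r b d : List Bool) (v : Ctl) (i : List GSymbol) :
    Runs (flush .e [.a]) ⟨v, tapes r b [] d t.code.reverse, i⟩
      ⟨Ctl.start, tapes (t.code ++ r) b [] d [], i⟩ (2 * t.size + 3) :=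
  flush_runs_of_eq (by simp) (by simp) (fun j => by cases j <;> simp [flushed]) (by simp [size])

/-- Exchange the two top trees. -/
def swap : Cmd := .seq (mv .b) (.seq (mv .d) (.seq (flush .b [.a]) (flush .d [.a])))

theorem swap_runs (s t : Bin) (r : List Bool) :
    Runs swap (mem (s.code ++ (t.code ++ r))) (mem (t.code ++ (s.code ++ r)))
      (7 * (s.size + t.size) + 12) :=
  .seq (mv_b_runs s _ [] [] _ _) (.seq (mv_d_runs t _ _ _ _ _)
    (.seq (flush_b_runs s _ _ _ _ _) (flush_d_runs t _ _ _ _ _) le_rfl) le_rfl) (by omega)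

/-- Exchange the second and the third tree. -/
def swapUnder : Cmd :=
  .seq (mv .b) (.seq (mv .d) (.seq (mv .e)
    (.seq (flush .d [.a]) (.seq (flush .e [.a]) (flush .b [.a])))))

theorem swapUnder_runs (s t u : Bin) (r : List Bool) :
    Runs swapUnder (mem (s.code ++ (t.code ++ (u.code ++ r))))
      (mem (s.code ++ (u.code ++ (t.code ++ r)))) (7 * (s.size + t.size + u.size) + 18) :=
  .seq (mv_b_runs s _ [] [] _ _) (.seq (mv_d_runs t _ _ _ _ _) (.seq (mv_e_runs u _ _ _ _ _)
    (.seq (flush_d_runs t _ _ _ _ _) (.seq (flush_e_runs u _ _ _ _ _) (flush_b_runs s _ _ _ _ _)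
      le_rfl) le_rfl) le_rfl) le_rfl) (by omega)

/-- Remove the top tree. -/
def drop : Cmd := .seq (mv .b) (flush .b [])

theorem drop_runs (s : Bin) (r : List Bool) :
    Runs drop (mem (s.code ++ r)) (mem r) (7 * s.size + 6) :=
  .seq (mv_b_runs s _ [] [] _ _) (flush_runs_of_eq (by simp) (by simp)
    (fun j => by cases j <;> simp [flushed]) (T := 2 * s.size + 3) (by simp [size])) (by omega)

/-- Duplicate the top tree. -/
def dup : Cmd :=
  .seq (mv .b) (.seq (flush .b [.a, .d]) (.seq (flush .d [.e]) (flush .e [.a])))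

theorem dup_runs (s : Bin) (r : List Bool) :
    Runs dup (mem (s.code ++ r)) (mem (s.code ++ (s.code ++ r))) (11 * s.size + 12) :=
  .seq (mv_b_runs s _ [] [] _ _) (.seq (T₁ := 2 * s.size + 3)
    (flush_runs_of_eq (s' := tapes (s.code ++ r) [] [] s.code []) (by simp) (by simp)
      (fun j => by cases j <;> simp [flushed]) (by simp [size]))
    (.seq (T₁ := 2 * s.size + 3)
      (flush_runs_of_eq (s' := tapes (s.code ++ r) [] [] [] s.code.reverse) (by simp) (by simp)
        (fun j => by cases j <;> simp [flushed]) (by simp [size]))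
      (flush_e_runs s _ _ _ _ _) le_rfl) le_rfl) (by omega)

/-- Push the empty tree. -/
def pushNil : Cmd := .basic [pushC .a false]

theorem pushNil_runs (r : List Bool) : Runs pushNil (mem r) (mem (nil.code ++ r)) 1 :=
  .basic (by simp [pushC, Instr.eval, mem, code]) le_rfl

/-- Replace the two top trees by the tree with these two subtrees. -/
def pushNode : Cmd := .basic [pushC .a true]

theorem pushNode_runs (s t : Bin) (r : List Bool) :
    Runs pushNode (mem (s.code ++ (t.code ++ r))) (mem ((node s t).code ++ r)) 1 :=
  .basic (by simp [pushC, Instr.eval, mem, code]) le_rfl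

/-- Take the top tree apart and continue according to its form. -/
def cases (p q : Cmd) : Cmd :=
  .seq (.basic [popX .a]) (.ite (fun v => v.x = some true) (.seq (.basic [reset]) p)
    (.seq (.basic [reset]) q))

theorem cases_node_runs {p q : Cmd} {s t : Bin} {r : List Bool} {m' : Mem} {T : ℕ}
    (h : Runs p (mem (s.code ++ (t.code ++ r))) m' T) :
    Runs (cases p q) (mem ((node s t).code ++ r)) m' (T + 3) := by
  refine .seq (.basic rfl le_rfl) (.ite_true ?_ (.seq (.basic rfl le_rfl) (h.congr_left ?_) le_rfl)
    le_rfl) (by omega)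
  · simp [popX, Instr.eval, mem, code]
  · simp [popX, reset, Instr.eval, mem, code]

theorem cases_nil_runs {p q : Cmd} {r : List Bool} {m' : Mem} {T : ℕ} (h : Runs q (mem r) m' T) :
    Runs (cases p q) (mem (nil.code ++ r)) m' (T + 3) := by
  refine .seq (.basic rfl le_rfl) (.ite_false ?_ (.seq (.basic rfl le_rfl) (h.congr_left ?_) le_rfl)
    le_rfl) (by omega)
  · simp [popX, Instr.eval, mem, code]
  · simp [popX, reset, Instr.eval, mem, code]

/-- Take the top tree apart and continue with `p`, until the top tree is empty. -/
def whileNode (p : Cmd) : Cmd :=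
  .seq (.basic [popX .a]) (.seq (.loop (fun v => v.x = some true)
    (.seq (.basic [reset]) (.seq p (.basic [popX .a])))) (.basic [reset]))

theorem whileNode_nil_runs (p : Cmd) (r : List Bool) :
    Runs (whileNode p) (mem (nil.code ++ r)) (mem r) 3 := by
  refine .seq (.basic rfl le_rfl) (.seq (.loop_false ?_ le_rfl) (.basic ?_ le_rfl) le_rfl) le_rfl
  · simp [popX, Instr.eval, mem, code]
  · simp [popX, reset, Instr.eval, mem, code]

theorem whileNode_node_runs {p : Cmd} {s t : Bin} {r r' : List Bool} {m' : Mem} {T₁ T₂ : ℕ}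
    (h₁ : Runs p (mem (s.code ++ (t.code ++ r))) (mem r') T₁)
    (h₂ : Runs (whileNode p) (mem r') m' T₂) :
    Runs (whileNode p) (mem ((node s t).code ++ r)) m' (T₁ + T₂ + 3) := by
  obtain ⟨n₂, l₂, e₂⟩ := h₂
  cases e₂ with
  | seq e₃ e₄ =>
    cases e₃
    refine .seq (.basic rfl le_rfl) (.seq_loop_true ?_ (.seq (.basic rfl le_rfl)
      (.seq (h₁.congr_left ?_) (.basic rfl le_rfl) le_rfl) le_rfl) ⟨_, le_rfl, e₄⟩ le_rfl)
      (by omega)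
    · simp [popX, Instr.eval, mem, code]
    · simp [popX, reset, Instr.eval, mem, code]

/-- The truth values as trees. -/
def ofBool : Bool → Bin
  | true => node nil nil
  | false => nil

/-- Compare the stacks `b` and `d`. -/
def compareLoop : Cmd :=
  .loop (fun v => v.x.isSome || v.y.isSome)
    (.basic [.load fun v => { v with flag := v.flag && v.x == v.y }, popX .b, popY .d])

/-- Replace the two top trees by the truth value of their equality. -/
def eqTest : Cmd :=
  .seq (mv .b) (.seq (mv .d) (.seq
    (.basic [.load fun v => { v with flag := true }, popX .b, popY .d]) (.seq compareLoop
      (.ite (fun v => v.flag) (.basic [pushC .a false, pushC .a false, pushC .a true, reset])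
        (.basic [pushC .a false, reset])))))

theorem compareLoop_runs (a c e : List Bool) (i : List GSymbol) (n : ℕ) : ∀ (p q : List Bool)
    (v : Ctl), p.length + q.length ≤ n → v.x = p.head? → v.y = q.head? →
      ∃ v' : Ctl, v'.flag = (v.flag && (p == q)) ∧ Runs compareLoop
        ⟨v, tapes a p.tail c q.tail e, i⟩ ⟨v', tapes a [] c [] e, i⟩ (2 * n + 1) := by
  induction n with
  | zero =>
    intro p q v h hx hy
    obtain rfl : p = [] := List.length_eq_zero_iff.1 (by omega)
    obtain rfl : q = [] := List.length_eq_zero_iff.1 (by omega)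
    exact ⟨v, by simp, .loop_false (by simp [hx, hy]) le_rfl⟩
  | succ n ih =>
    intro p q v h hx hy
    by_cases hpq : p = [] ∧ q = []
    · obtain ⟨rfl, rfl⟩ := hpq
      exact ⟨v, by simp, .loop_false (by simp [hx, hy]) (by omega)⟩
    · obtain ⟨v', hv', h'⟩ := ih p.tail q.tail
        ⟨p.tail.head?, q.tail.head?, v.flag && v.x == v.y, v.sym⟩
        (by
          simp only [List.length_tail]
          by_cases hp : p = []
          · have := List.length_pos_iff.2 fun hq => hpq ⟨hp, hq⟩
            omega
          · have := List.length_pos_iff.2 hp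
            omega) rfl rfl
      refine ⟨v', ?_, .loop_true ?_ (.basic rfl le_rfl) (h'.congr_left ?_) (by omega)⟩
      · rw [hv', hx, hy]
        cases p <;> cases q <;> simp [Bool.and_assoc]
      · rw [hx, hy]
        cases p <;> cases q <;> simp_all
      · simp [Instr.eval, popX, popY]

theorem eqTest_runs (s t : Bin) (r : List Bool) :
    Runs eqTest (mem (s.code ++ (t.code ++ r))) (mem ((ofBool (s = t)).code ++ r))
      (7 * (s.size + t.size) + 10) := by
  obtain ⟨v, hv, h⟩ := compareLoop_runs r [] [] [] (s.size + t.size) s.code.reverse t.code.reverse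
    ⟨s.code.reverse.head?, t.code.reverse.head?, true, none⟩ (by simp [size]) rfl rfl
  simp only [Bool.true_and] at hv
  have hst : (s.code.reverse == t.code.reverse) = decide (s = t) := by
    rw [Bool.eq_iff_iff]
    simp [code_injective.eq_iff]
  rw [hst] at hv
  refine .seq (mv_b_runs s _ [] [] _ _) (.seq (mv_d_runs t _ _ _ _ _) (.seq (.basic rfl le_rfl)
    (.seq (h.congr_left ?_) (T₂ := 2) ?_ le_rfl) le_rfl) le_rfl) (by omega)
  · simp [Instr.eval, popX, popY, Ctl.start]
  · by_cases hd : s = t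
    · refine .ite_true (by simpa [hd] using hv) (.basic ?_ le_rfl) le_rfl
      simp [pushC, reset, Instr.eval, mem, hd, ofBool, code]
    · refine .ite_false (by simpa [hd] using hv) (.basic ?_ le_rfl) le_rfl
      simp [pushC, reset, Instr.eval, mem, hd, ofBool, code]

open Bin

/-! ### Data types encoded as trees -/

/-- Types whose elements are encoded as binary trees. -/
class Enc (α : Type) where
  enc : α → Bin
  enc_injective : Function.Injective enc

open Enc

/-- The size of the code of an element. -/
def sz {α : Type} [Enc α] (x : α) : ℕ := (enc x).size

instance : Enc Bool where
  enc := ofBool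
  enc_injective := by
    intro a b h
    cases a <;> cases b <;> simp_all [ofBool]

instance {α β : Type} [Enc α] [Enc β] : Enc (α × β) where
  enc x := node (enc x.1) (enc x.2)
  enc_injective := by
    intro x y h
    simp only [node.injEq] at h
    exact Prod.ext (enc_injective h.1) (enc_injective h.2)

instance {α : Type} [Enc α] : Enc (Option α) where
  enc x := x.elim nil fun a => node (enc a) nil
  enc_injective := by
    intro x y h
    cases x <;> cases y <;> simp_all [enc_injective.eq_iff]

/-- The code of a list. -/
def encList {α : Type} [Enc α] : List α → Bin
  | [] => nil
  | a :: l => node (enc a) (encList l)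

instance {α : Type} [Enc α] : Enc (List α) where
  enc := encList
  enc_injective := by
    intro l
    induction l with
    | nil =>
      intro l' h
      cases l' <;> simp_all [encList]
    | cons a l ih =>
      intro l' h
      cases l' with
      | nil => simp [encList] at h
      | cons b l' =>
        simp only [encList, node.injEq] at h
        rw [enc_injective h.1, ih h.2]

/-- Unary codes of numbers. -/
def unary : ℕ → Bin
  | 0 => nil
  | n + 1 => node nil (unary n)

theorem unary_injective : Function.Injective unary := by
  intro m
  induction m with
  | zero =>
    intro n h
    cases n <;> simp_all [unary]
  | succ m ih =>
    intro n h
    cases n with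
    | zero => simp [unary] at h
    | succ n =>
      simp only [unary, node.injEq, true_and] at h
      rw [ih h]

theorem enc_prod {α β : Type} [Enc α] [Enc β] (x : α × β) : enc x = node (enc x.1) (enc x.2) := rfl

theorem enc_cons {α : Type} [Enc α] (a : α) (l : List α) : enc (a :: l) = node (enc a) (enc l) :=
  rfl

@[simp] theorem sz_prod {α β : Type} [Enc α] [Enc β] (a : α) (b : β) :
    sz (a, b) = sz a + sz b + 1 := by
  simp [sz, enc_prod]

@[simp] theorem sz_nil {α : Type} [Enc α] : sz ([] : List α) = 1 := rfl

@[simp] theorem sz_cons {α : Type} [Enc α] (a : α) (l : List α) :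
    sz (a :: l) = sz a + sz l + 1 := by
  simp [sz, enc_cons]

theorem length_le_sz {α : Type} [Enc α] (l : List α) : l.length ≤ sz l := by
  induction l with
  | nil => simp
  | cons a l ih =>
    simp only [List.length_cons, sz_cons]
    omega

theorem sz_le_of_mem {α : Type} [Enc α] {l : List α} {a : α} (h : a ∈ l) : sz a ≤ sz l := by
  induction l with
  | nil => simp at h
  | cons b l ih =>
    simp only [sz_cons]
    rcases List.mem_cons.1 h with rfl | h
    · omega
    · have := ih h
      omega

theorem sz_sublist {α : Type} [Enc α] {l l' : List α} (h : l.Sublist l') : sz l ≤ sz l' := by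
  induction h with
  | slnil => exact le_rfl
  | cons a _ ih =>
    simp only [sz_cons]
    omega
  | cons_cons a _ ih =>
    simp only [sz_cons]
    omega

theorem sz_append {α : Type} [Enc α] (l l' : List α) : sz (l ++ l') ≤ sz l + sz l' := by
  induction l with
  | nil => simp
  | cons a l ih =>
    simp only [List.cons_append, sz_cons]
    omega

theorem sz_bool (b : Bool) : sz b ≤ 3 := by
  cases b <;> decide

/-! ### Functions computable in polynomial time -/

theorem eval_mono (P : Polynomial ℕ) {m n : ℕ} (h : m ≤ n) : P.eval m ≤ P.eval n := by
  simp only [Polynomial.eval_eq_sum_range]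
  gcongr

/-- `f` is computed by a program on the tree stack, and the running time and the size of the value
are bounded by a polynomial in the size of the argument. -/
def PolyTime {α β : Type} [Enc α] [Enc β] (f : α → β) : Prop :=
  ∃ (p : Cmd) (P : Polynomial ℕ), ∀ x,
    (∀ r, Runs p (mem ((enc x).code ++ r)) (mem ((enc (f x)).code ++ r)) (P.eval (sz x))) ∧
      sz (f x) ≤ P.eval (sz x)

variable {α β γ δ σ : Type} [Enc α] [Enc β] [Enc γ] [Enc δ] [Enc σ]

theorem PolyTime.of_enc_eq {f : α → β} {g : γ → δ} (h : PolyTime f) (φ : γ → α)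
    (hφ : ∀ x, enc x = enc (φ x)) (hg : ∀ x, enc (g x) = enc (f (φ x))) : PolyTime g := by
  obtain ⟨p, P, hp⟩ := h
  refine ⟨p, P, fun x => ?_⟩
  have := hp (φ x)
  simpa only [sz, hφ, hg] using this

theorem PolyTime.congr {f g : α → β} (h : PolyTime f) (hg : ∀ x, g x = f x) : PolyTime g :=
  (funext hg : g = f) ▸ h

theorem PolyTime.self : PolyTime fun x : α => x :=
  ⟨.basic [], .X + 1, fun x => ⟨fun _ => .basic rfl (by simp), by simp⟩⟩

theorem PolyTime.comp {g : β → γ} {f : α → β} (hg : PolyTime g) (hf : PolyTime f) :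
    PolyTime fun x => g (f x) := by
  obtain ⟨p, P, hp⟩ := hf
  obtain ⟨q, Q, hq⟩ := hg
  refine ⟨.seq p q, P + Q.comp P, fun x => ⟨fun r => ?_, ?_⟩⟩
  · refine .seq ((hp x).1 r) ((hq (f x)).1 r) ?_
    have := eval_mono Q (hp x).2
    simp only [Polynomial.eval_add, Polynomial.eval_comp]
    omega
  · have := eval_mono Q (hp x).2
    have := (hq (f x)).2
    simp only [Polynomial.eval_add, Polynomial.eval_comp]
    omega

theorem PolyTime.pair {f : α → β} {g : α → γ} (hf : PolyTime f) (hg : PolyTime g) :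
    PolyTime fun x => (f x, g x) := by
  obtain ⟨p, P, hp⟩ := hf
  obtain ⟨q, Q, hq⟩ := hg
  refine ⟨.seq dup (.seq p (.seq swap (.seq q (.seq swap pushNode)))),
    20 * .X + 20 * P + 20 * Q + 40, fun x => ⟨fun r => ?_, ?_⟩⟩
  · refine .seq (dup_runs _ _) (.seq ((hp x).1 _) (.seq (swap_runs _ _ _) (.seq ((hq x).1 _)
      (.seq (swap_runs _ _ _) (pushNode_runs _ _ _) le_rfl) le_rfl) le_rfl) le_rfl) ?_
    have h1 := (hp x).2
    have h2 := (hq x).2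
    simp only [Polynomial.eval_add, Polynomial.eval_mul, Polynomial.eval_ofNat,
      Polynomial.eval_X]
    simp only [sz] at *
    omega
  · have h1 := (hp x).2
    have h2 := (hq x).2
    simp only [Polynomial.eval_add, Polynomial.eval_mul, Polynomial.eval_ofNat,
      Polynomial.eval_X, sz_prod]
    omega

/-- A program that pushes a fixed tree. -/
def pushTree : Bin → Cmd
  | nil => pushNil
  | node s t => .seq (pushTree t) (.seq (pushTree s) pushNode)

theorem pushTree_runs (t : Bin) (r : List Bool) :
    Runs (pushTree t) (mem r) (mem (t.code ++ r)) (2 * t.size) := by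
  induction t generalizing r with
  | nil => exact (pushNil_runs r).mono (by simp)
  | node s t ihs iht =>
    refine .seq (iht r) (.seq (ihs _) (pushNode_runs s t r) le_rfl) ?_
    simp only [size_node]
    omega

theorem PolyTime.const (b : β) : PolyTime fun _ : α => b := by
  refine ⟨.seq drop (pushTree (enc b)), 7 * .X + 6 + .C (2 * sz b), fun x => ⟨fun r => ?_, ?_⟩⟩
  · refine .seq (drop_runs _ _) (pushTree_runs _ _) ?_
    simp only [Polynomial.eval_add, Polynomial.eval_mul, Polynomial.eval_ofNat,
      Polynomial.eval_X, Polynomial.eval_C]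
    simp only [sz]
    omega
  · simp only [Polynomial.eval_add, Polynomial.eval_mul, Polynomial.eval_ofNat,
      Polynomial.eval_X, Polynomial.eval_C]
    omega

theorem PolyTime.fst : PolyTime fun x : α × β => x.1 := by
  refine ⟨cases (.seq swap drop) pushNil, 14 * .X + 30, fun x => ⟨fun r => ?_, ?_⟩⟩
  · refine (cases_node_runs (.seq (swap_runs _ _ _) (drop_runs _ _) le_rfl)).mono ?_
    obtain ⟨a, b⟩ := x
    simp only [Polynomial.eval_add, Polynomial.eval_mul, Polynomial.eval_ofNat,
      Polynomial.eval_X, sz_prod]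
    simp only [sz]
    omega
  · obtain ⟨a, b⟩ := x
    simp only [Polynomial.eval_add, Polynomial.eval_mul, Polynomial.eval_ofNat,
      Polynomial.eval_X, sz_prod]
    omega

theorem PolyTime.snd : PolyTime fun x : α × β => x.2 := by
  refine ⟨cases drop pushNil, 7 * .X + 30, fun x => ⟨fun r => ?_, ?_⟩⟩
  · refine (cases_node_runs (drop_runs _ _)).mono ?_
    obtain ⟨a, b⟩ := x
    simp only [Polynomial.eval_add, Polynomial.eval_mul, Polynomial.eval_ofNat,
      Polynomial.eval_X, sz_prod]
    simp only [sz]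
    omega
  · obtain ⟨a, b⟩ := x
    simp only [Polynomial.eval_add, Polynomial.eval_mul, Polynomial.eval_ofNat,
      Polynomial.eval_X, sz_prod]
    omega

/-- Case distinction on the form of the code of `c x`: it is empty, or it is a node with the codes
of `a` and `b`. -/
theorem PolyTime.treeCases {c : γ → δ} {f : γ → σ} {g : γ × α × β → σ} {h : γ → σ}
    (hc : PolyTime c) (hf : PolyTime f) (hg : PolyTime g)
    (H : ∀ x, (enc (c x) = nil ∧ h x = f x) ∨
      ∃ a b, enc (c x) = node (enc a) (enc b) ∧ h x = g (x, a, b)) : PolyTime h := by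
  obtain ⟨p, P, hp⟩ := hc
  obtain ⟨q, Q, hq⟩ := hf
  obtain ⟨s, S, hs⟩ := hg
  refine ⟨.seq dup (.seq p (cases (.seq pushNode (.seq swap (.seq pushNode s))) q)),
    20 * .X + 20 * P + Q + S.comp (.X + P + 1) + 40, fun x => ?_⟩
  have e1 := (hp x).2
  rcases H x with ⟨hx, hh⟩ | ⟨a, b, hx, hh⟩
  · refine ⟨fun r => ?_, ?_⟩
    · have e2 := (hp x).1 ((enc x).code ++ r)
      rw [hx] at e2
      rw [hh]
      refine .seq (dup_runs _ _) (.seq e2 (cases_nil_runs ((hq x).1 r)) le_rfl) ?_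
      · simp only [Polynomial.eval_add, Polynomial.eval_mul, Polynomial.eval_ofNat,
          Polynomial.eval_X]
        simp only [sz] at *
        omega
    · rw [hh]
      have := (hq x).2
      simp only [Polynomial.eval_add, Polynomial.eval_mul, Polynomial.eval_ofNat,
          Polynomial.eval_X]
      omega
  · have e3 : sz (x, a, b) ≤ sz x + P.eval (sz x) + 1 := by
      rw [sz_prod]
      have : sz (a, b) = sz (c x) := by simp only [sz, hx, enc_prod]
      omega
    have e4 := eval_mono S e3
    refine ⟨fun r => ?_, ?_⟩
    · have e2 := (hp x).1 ((enc x).code ++ r)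
      rw [hx] at e2
      rw [hh]
      refine .seq (dup_runs _ _) (.seq e2 (cases_node_runs (.seq (pushNode_runs _ _ _)
        (.seq (swap_runs _ _ _) (.seq (pushNode_runs _ _ _) ((hs (x, a, b)).1 r) le_rfl) le_rfl)
        le_rfl)) le_rfl) ?_
      · have e5 : (node (enc a) (enc b)).size = sz (c x) := by rw [sz, hx]
        rw [e5]
        simp only [Polynomial.eval_add, Polynomial.eval_mul, Polynomial.eval_ofNat,
          Polynomial.eval_X, Polynomial.eval_comp, Polynomial.eval_one]
        simp only [sz] at *
        omega
    · rw [hh]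
      have := (hs (x, a, b)).2
      simp only [Polynomial.eval_add, Polynomial.eval_mul, Polynomial.eval_ofNat,
          Polynomial.eval_X, Polynomial.eval_comp, Polynomial.eval_one]
      omega

theorem PolyTime.ite {c : γ → Bool} {f g : γ → σ} (hc : PolyTime c) (hf : PolyTime f)
    (hg : PolyTime g) : PolyTime fun x => if c x then f x else g x := by
  refine PolyTime.treeCases (α := List Bool) (β := List Bool) (g := fun x => f x.1) hc hg
    (hf.comp .fst) fun x => ?_
  cases h : c x with
  | false => exact Or.inl ⟨rfl, by simp⟩
  | true => exact Or.inr ⟨[], [], rfl, by simp⟩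

theorem PolyTime.listCases {l : γ → List α} {f : γ → σ} {g : γ × α × List α → σ} {h : γ → σ}
    (hl : PolyTime l) (hf : PolyTime f) (hg : PolyTime g) (hnil : ∀ x, l x = [] → h x = f x)
    (hcons : ∀ x a t, l x = a :: t → h x = g (x, a, t)) : PolyTime h := by
  refine PolyTime.treeCases hl hf hg fun x => ?_
  cases hx : l x with
  | nil => exact Or.inl ⟨rfl, hnil x hx⟩
  | cons a t => exact Or.inr ⟨a, t, rfl, hcons x a t hx⟩

theorem PolyTime.optionCases {o : γ → Option α} {f : γ → σ} {g : γ × α → σ} {h : γ → σ}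
    (ho : PolyTime o) (hf : PolyTime f) (hg : PolyTime g) (hnone : ∀ x, o x = none → h x = f x)
    (hsome : ∀ x a, o x = some a → h x = g (x, a)) : PolyTime h := by
  refine PolyTime.treeCases (α := α) (β := List Bool) (g := fun x => g (x.1, x.2.1)) ho hf
    (hg.comp (.pair .fst (.comp .fst .snd))) fun x => ?_
  cases hx : o x with
  | none => exact Or.inl ⟨rfl, hnone x hx⟩
  | some a => exact Or.inr ⟨a, [], rfl, hsome x a hx⟩

theorem PolyTime.eq [DecidableEq β] {f g : α → β} (hf : PolyTime f) (hg : PolyTime g) :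
    PolyTime fun x => decide (f x = g x) := by
  have key : PolyTime fun x : β × β => decide (x.1 = x.2) := by
    refine ⟨cases eqTest pushNil, 7 * .X + 30, fun x => ⟨fun r => ?_, ?_⟩⟩
    · have hd : (decide (enc x.1 = enc x.2)) = decide (x.1 = x.2) := by
        rw [Bool.eq_iff_iff]
        simp [enc_injective.eq_iff]
      have h := eqTest_runs (enc x.1) (enc x.2) r
      rw [hd] at h
      refine (cases_node_runs h).mono ?_
      obtain ⟨a, b⟩ := x
      simp only [Polynomial.eval_add, Polynomial.eval_mul, Polynomial.eval_ofNat,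
        Polynomial.eval_X, sz_prod]
      simp only [sz]
      omega
    · have := sz_bool (decide (x.1 = x.2))
      simp only [Polynomial.eval_add, Polynomial.eval_mul, Polynomial.eval_ofNat,
        Polynomial.eval_X]
      omega
  exact key.comp (.pair hf hg)

theorem PolyTime.optionSome {f : α → β} (hf : PolyTime f) : PolyTime fun x => some (f x) :=
  (hf.pair (.const ([] : List Bool))).of_enc_eq (fun x => x) (fun _ => rfl) fun _ => rfl

theorem PolyTime.cons {f : α → β} {l : α → List β} (hf : PolyTime f) (hl : PolyTime l) :
    PolyTime fun x => f x :: l x :=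
  (hf.pair hl).of_enc_eq (fun x => x) (fun _ => rfl) fun _ => rfl

theorem sz_foldl_le {ι τ : Type} [Enc τ] {step : τ → ι → τ} {g : ℕ} (l : List ι)
    (h : ∀ s, ∀ a ∈ l, sz (step s a) ≤ sz s + g) (s : τ) :
    sz (l.foldl step s) ≤ sz s + l.length * g := by
  induction l generalizing s with
  | nil => simp
  | cons a l ih =>
    have h1 := ih (fun s b hb => h s b (List.mem_cons_of_mem _ hb)) (step s a)
    have h2 := h s a List.mem_cons_self
    simp only [List.foldl_cons, List.length_cons, Nat.add_mul, Nat.one_mul]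
    omega

theorem foldl_loop_runs {step : γ → σ → α → σ} {p : Cmd} {P : Polynomial ℕ}
    (hp : ∀ q : α × γ × σ,
      (∀ r, Runs p (mem ((enc q).code ++ r))
        (mem ((enc (q.2.1, step q.2.1 q.2.2 q.1)).code ++ r)) (P.eval (sz q))) ∧
      sz (q.2.1, step q.2.1 q.2.2 q.1) ≤ P.eval (sz q))
    (x : γ) (g L B : ℕ) (l : List α) (hl : sz l ≤ L)
    (hg : ∀ s, ∀ a ∈ l, sz (step x s a) ≤ sz s + g) (r : List Bool) :
    ∀ s, sz s + l.length * g ≤ B →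
      Runs (whileNode (.seq swapUnder (.seq pushNode (.seq p swap))))
        (mem ((enc l).code ++ ((enc (x, s)).code ++ r)))
        (mem ((enc (x, l.foldl (step x) s)).code ++ r))
        (l.length * (40 + 30 * L + 10 * sz x + 10 * B + 10 * P.eval (L + sz x + B + 2)) + 3) := by
  induction l with
  | nil =>
    intro s _
    exact (whileNode_nil_runs _ _).mono (by simp)
  | cons a l ih =>
    intro s hs
    simp only [sz_cons] at hl
    simp only [List.length_cons, Nat.add_mul, Nat.one_mul] at hs ⊢
    have h1 := hg s a List.mem_cons_self
    have h2 := ih (by omega) (fun s b hb => hg s b (List.mem_cons_of_mem _ hb)) (step x s a)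
      (by omega)
    have h3 : sz (a, x, s) ≤ L + sz x + B + 2 := by
      simp only [sz_prod]
      omega
    have h4 := eval_mono P h3
    have h5 := (hp (a, x, s)).2
    refine (whileNode_node_runs (.seq (swapUnder_runs _ _ _ _) (.seq (pushNode_runs _ _ _)
      (.seq ((hp (a, x, s)).1 _) (swap_runs _ _ _) le_rfl) le_rfl) le_rfl) h2).mono ?_
    have h6 : (enc (x, s)).size = sz x + sz s + 1 := sz_prod x s
    rw [h6]
    simp only [sz] at *
    simp only [enc] at *
    omega

theorem PolyTime.foldl {l : γ → List α} {init : γ → σ} {step : γ → σ → α → σ} (hl : PolyTime l)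
    (hi : PolyTime init) (hs : PolyTime fun q : γ × σ × α => step q.1 q.2.1 q.2.2)
    (G : Polynomial ℕ)
    (hG : ∀ x s a, a ∈ l x → sz (step x s a) ≤ sz s + G.eval (sz x)) :
    PolyTime fun x => (l x).foldl (step x) (init x) := by
  have hs' : PolyTime fun q : α × γ × σ => (q.2.1, step q.2.1 q.2.2 q.1) :=
    .pair (.comp .fst .snd)
      (hs.comp (f := fun q : α × γ × σ => (q.2.1, q.2.2, q.1))
        (.pair (.comp .fst .snd) (.pair (.comp .snd .snd) .fst)))
  have h0 : PolyTime fun x => (l x, x, init x) := .pair hl (.pair .self hi)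
  obtain ⟨p, P, hp⟩ := hs'
  obtain ⟨q, Q, hq⟩ := h0
  refine PolyTime.comp (g := fun y : γ × σ => y.2)
    (f := fun x => (x, (l x).foldl (step x) (init x))) .snd ?_
  let B : Polynomial ℕ := Q + Q * G
  refine ⟨.seq q (cases (whileNode (.seq swapUnder (.seq pushNode (.seq p swap)))) pushNil),
    Q + Q * (40 + 30 * Q + 10 * .X + 10 * B + 10 * P.comp (Q + .X + B + 2)) + 20 + .X + B,
    fun x => ?_⟩
  have e1 := (hq x).2
  simp only [sz_prod] at e1
  have e2 : (l x).length ≤ Q.eval (sz x) := (length_le_sz _).trans (by omega)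
  have e3 : sz (init x) + (l x).length * G.eval (sz x) ≤ B.eval (sz x) := by
    simp only [B, Polynomial.eval_add, Polynomial.eval_mul]
    have := Nat.mul_le_mul_right (G.eval (sz x)) e2
    omega
  refine ⟨fun r => ?_, ?_⟩
  · refine .seq ((hq x).1 r) (cases_node_runs (foldl_loop_runs hp x (G.eval (sz x)) (Q.eval (sz x))
      (B.eval (sz x)) (l x) (by omega) (hG x) r (init x) e3)) ?_
    have e4 := Nat.mul_le_mul_right (40 + 30 * Q.eval (sz x) + 10 * sz x + 10 * B.eval (sz x) +
      10 * P.eval (Q.eval (sz x) + sz x + B.eval (sz x) + 2)) e2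
    simp only [Polynomial.eval_add, Polynomial.eval_mul, Polynomial.eval_ofNat,
      Polynomial.eval_X, Polynomial.eval_comp]
    omega
  · have e5 := sz_foldl_le (l x) (hG x) (init x)
    simp only [Polynomial.eval_add, Polynomial.eval_X, sz_prod, Polynomial.eval_ofNat]
    omega

open Bin Enc

variable {α β γ δ σ : Type} [Enc α] [Enc β] [Enc γ] [Enc δ] [Enc σ]

/-! ### Logic and list functions -/

theorem PolyTime.not {f : γ → Bool} (hf : PolyTime f) : PolyTime fun x => !f x :=
  (PolyTime.ite hf (.const false) (.const true)).congr fun x => by cases f x <;> rfl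

theorem PolyTime.and {f g : γ → Bool} (hf : PolyTime f) (hg : PolyTime g) :
    PolyTime fun x => f x && g x :=
  (PolyTime.ite hf hg (.const false)).congr fun x => by cases f x <;> rfl

theorem PolyTime.or {f g : γ → Bool} (hf : PolyTime f) (hg : PolyTime g) :
    PolyTime fun x => f x || g x :=
  (PolyTime.ite hf (.const true) hg).congr fun x => by cases f x <;> rfl

theorem PolyTime.all {l : γ → List α} {p : γ → α → Bool} (hl : PolyTime l)
    (hp : PolyTime fun q : γ × α => p q.1 q.2) : PolyTime fun x => (l x).all (p x) := by
  refine (PolyTime.foldl (init := fun _ => true) (step := fun x s a => s && p x a) hl (.const true)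
    (.and (.comp .fst .snd) (hp.comp (.pair .fst (.comp .snd .snd)))) 3
    fun x s a _ => (sz_bool _).trans (by simp)).congr fun x => ?_
  have : ∀ (b : Bool) (l : List α), l.foldl (fun s a => s && p x a) b = (b && l.all (p x)) := by
    intro b l
    induction l generalizing b with
    | nil => simp
    | cons a l ih => rw [List.foldl_cons, ih, List.all_cons, Bool.and_assoc]
  rw [this, Bool.true_and]

theorem PolyTime.any {l : γ → List α} {p : γ → α → Bool} (hl : PolyTime l)
    (hp : PolyTime fun q : γ × α => p q.1 q.2) : PolyTime fun x => (l x).any (p x) :=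
  (PolyTime.not (PolyTime.all hl hp.not)).congr fun x => by
    rw [List.any_eq_not_all_not]

theorem PolyTime.appendReverse {l m : γ → List α} (hl : PolyTime l) (hm : PolyTime m) :
    PolyTime fun x => (l x).reverse ++ m x := by
  obtain ⟨p, P, hp⟩ := id hl
  refine (PolyTime.foldl (step := fun _ s a => a :: s) hl hm
    (.cons (.comp .snd .snd) (.comp .fst .snd)) (P + 1) fun x s a ha => ?_).congr fun x => ?_
  · have h1 := sz_le_of_mem ha
    have h2 := (hp x).2
    simp only [sz_cons, Polynomial.eval_add, Polynomial.eval_one]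
    omega
  · have : ∀ (l m : List α), l.foldl (fun s a => a :: s) m = l.reverse ++ m := by
      intro l
      induction l with
      | nil => simp
      | cons a l ih =>
        intro m
        rw [List.foldl_cons, ih]
        simp
    rw [this]

theorem PolyTime.reverse {l : γ → List α} (hl : PolyTime l) : PolyTime fun x => (l x).reverse :=
  (hl.appendReverse (.const [])).congr fun x => by simp

theorem PolyTime.append {l m : γ → List α} (hl : PolyTime l) (hm : PolyTime m) :
    PolyTime fun x => l x ++ m x :=
  (hl.reverse.appendReverse hm).congr fun x => by simp

theorem PolyTime.flatMap {l : γ → List α} {f : γ → α → List β} (hl : PolyTime l)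
    (hf : PolyTime fun q : γ × α => f q.1 q.2) : PolyTime fun x => (l x).flatMap (f x) := by
  obtain ⟨p, P, hp⟩ := id hl
  obtain ⟨q, Q, hq⟩ := id hf
  refine (PolyTime.foldl (init := fun _ => []) (step := fun x s a => s ++ f x a) hl (.const [])
    (.append (.comp .fst .snd) (hf.comp (.pair .fst (.comp .snd .snd)))) (Q.comp (.X + P + 1))
    fun x s a ha => ?_).congr fun x => ?_
  · have h1 := sz_le_of_mem ha
    have h2 := (hp x).2
    have h3 : sz (f x a) ≤ _ := (hq (x, a)).2
    have h4 := eval_mono Q (show sz (x, a) ≤ sz x + P.eval (sz x) + 1 by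
      rw [sz_prod]
      omega)
    have h5 := sz_append s (f x a)
    simp only [Polynomial.eval_comp, Polynomial.eval_add, Polynomial.eval_one,
      Polynomial.eval_X]
    omega
  · have : ∀ (l : List α) (m : List β), l.foldl (fun s a => s ++ f x a) m = m ++ l.flatMap (f x) := by
      intro l
      induction l with
      | nil => simp
      | cons a l ih =>
        intro m
        rw [List.foldl_cons, ih]
        simp
    rw [this, List.nil_append]

theorem PolyTime.filter {l : γ → List α} {p : γ → α → Bool} (hl : PolyTime l)
    (hp : PolyTime fun q : γ × α => p q.1 q.2) : PolyTime fun x => (l x).filter (p x) := by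
  refine (PolyTime.flatMap (f := fun x a => if p x a then [a] else []) hl
    (.ite hp (.cons .snd (.const [])) (.const []))).congr fun x => ?_
  induction l x with
  | nil => rfl
  | cons a l ih =>
    rw [List.filter_cons, List.flatMap_cons, ih]
    cases p x a <;> simp

theorem PolyTime.map {l : γ → List α} {f : γ → α → β} (hl : PolyTime l)
    (hf : PolyTime fun q : γ × α => f q.1 q.2) : PolyTime fun x => (l x).map (f x) := by
  refine (PolyTime.flatMap (f := fun x a => [f x a]) hl (.cons hf (.const []))).congr fun x => ?_
  induction l x with
  | nil => rfl
  | cons a l ih => rw [List.map_cons, List.flatMap_cons, ih, List.singleton_append]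

theorem PolyTime.isEmpty {l : γ → List α} (hl : PolyTime l) : PolyTime fun x => (l x).isEmpty :=
  .listCases (g := fun _ => false) hl (.const true) (.const false) (fun x h => by simp [h])
    fun x a t h => by simp [h]

theorem PolyTime.tail {l : γ → List α} (hl : PolyTime l) : PolyTime fun x => (l x).tail :=
  .listCases (f := fun _ => []) (g := fun x => x.2.2) hl (.const []) (.comp .snd .snd)
    (fun x h => by simp [h]) fun x a t h => by simp [h]

theorem PolyTime.switch [Fintype α] [DecidableEq α] [Nonempty α] {c : γ → α} {f : α → γ → σ}
    (hc : PolyTime c) (hf : ∀ a, PolyTime (f a)) : PolyTime fun x => f (c x) x := by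
  have key : ∀ l : List α, ∃ h : γ → σ, PolyTime h ∧ ∀ x, c x ∈ l → h x = f (c x) x := by
    intro l
    induction l with
    | nil => exact ⟨f (Classical.arbitrary α), hf _, by simp⟩
    | cons a l ih =>
      obtain ⟨h, hh, he⟩ := ih
      refine ⟨_, PolyTime.ite (.eq hc (.const a)) (hf a) hh, fun x hx => ?_⟩
      by_cases hxa : c x = a
      · simp [hxa]
      · simp only [hxa, decide_false, Bool.false_eq_true, if_false]
        exact he x ((List.mem_cons.1 hx).resolve_left hxa)
  obtain ⟨h, hh, he⟩ := key Finset.univ.toList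
  exact hh.congr fun x => (he x (by simp)).symm

/-! ### Greatest fixed points -/

/-- The greatest sublist `X` of `l` all of whose elements `a` satisfy `p X a`, for a monotone `p`. -/
def gfp {ι : Type} (p : List ι → ι → Bool) (l : List ι) : List ι :=
  l.foldl (fun X _ => X.filter (p X)) l

theorem gfp_eq_iterate {ι : Type} (p : List ι → ι → Bool) (l : List ι) :
    gfp p l = (fun X => X.filter (p X))^[l.length] l := by
  have : ∀ m X : List ι, m.foldl (fun X _ => X.filter (p X)) X =
      (fun X => X.filter (p X))^[m.length] X := by
    intro m
    induction m with
    | nil => intro X; rfl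
    | cons a m ih =>
      intro X
      rw [List.foldl_cons, ih, List.length_cons, Function.iterate_succ_apply]
  exact this l l

theorem filter_gfp {ι : Type} (p : List ι → ι → Bool) (l : List ι) :
    (gfp p l).filter (p (gfp p l)) = gfp p l := by
  have : ∀ (n : ℕ) (X : List ι), X.length ≤ n →
      ((fun X => X.filter (p X))^[n] X).filter (p ((fun X => X.filter (p X))^[n] X)) =
        (fun X => X.filter (p X))^[n] X := by
    intro n
    induction n with
    | zero =>
      intro X hX
      obtain rfl : X = [] := List.length_eq_zero_iff.1 (by omega)
      rfl
    | succ n ih =>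
      intro X hX
      by_cases h : X.filter (p X) = X
      · have := Function.iterate_fixed (f := fun X : List ι => X.filter (p X)) h (n + 1)
        rw [this]
        exact h
      · rw [Function.iterate_succ_apply]
        refine ih _ ?_
        have h1 := List.length_filter_le (p X) X
        have h2 : (X.filter (p X)).length ≠ X.length := fun h' =>
          h (List.filter_sublist.eq_of_length h')
        omega
  rw [gfp_eq_iterate]
  exact this _ _ le_rfl

theorem of_mem_gfp {ι : Type} {p : List ι → ι → Bool} {l : List ι} {a : ι} (h : a ∈ gfp p l) :
    p (gfp p l) a = true := by
  rw [← filter_gfp] at h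
  exact (List.mem_filter.1 h).2

theorem mem_of_mem_gfp {ι : Type} {p : List ι → ι → Bool} {l : List ι} {a : ι}
    (h : a ∈ gfp p l) : a ∈ l := by
  have : ∀ m X : List ι, a ∈ m.foldl (fun X _ => X.filter (p X)) X → a ∈ X := by
    intro m
    induction m with
    | nil => exact fun X h => h
    | cons b m ih => exact fun X h => (List.mem_filter.1 (ih _ h)).1
  exact this l l h

theorem mem_gfp {ι : Type} {p : List ι → ι → Bool} {l : List ι} (Q : ι → Prop)
    (hp : ∀ X : List ι, (∀ a ∈ l, Q a → a ∈ X) → ∀ a ∈ l, Q a → p X a = true) {a : ι} (ha : a ∈ l)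
    (hQ : Q a) : a ∈ gfp p l := by
  have : ∀ m X : List ι, (∀ a ∈ l, Q a → a ∈ X) → ∀ a ∈ l, Q a →
      a ∈ m.foldl (fun X _ => X.filter (p X)) X := by
    intro m
    induction m with
    | nil => exact fun X h => h
    | cons b m ih =>
      intro X h
      exact ih _ fun a ha hQ => List.mem_filter.2 ⟨h a ha hQ, hp X h a ha hQ⟩
  exact this l l (fun a ha _ => ha) a ha hQ

theorem PolyTime.gfp {l : γ → List α} {p : γ → List α → α → Bool} (hl : PolyTime l)
    (hp : PolyTime fun q : (γ × List α) × α => p q.1.1 q.1.2 q.2) :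
    PolyTime fun x => gfp (p x) (l x) := by
  refine PolyTime.foldl (step := fun x X _ => X.filter (p x X)) hl hl ?_ 0 fun x s a _ => ?_
  · exact PolyTime.filter (γ := γ × List α × α) (p := fun q a => p q.1 q.2.1 a) (.comp .fst .snd)
      (hp.comp (f := fun q : (γ × List α × α) × α => ((q.1.1, q.1.2.1), q.2))
        (.pair (.pair (.comp .fst .fst) (.comp .fst (.comp .snd .fst))) .snd))
  · exact (sz_sublist List.filter_sublist).trans (by simp)

/-! ### Reading the input and writing the output -/

/-- A number for each symbol. -/
def symbolIndex : GSymbol → ℕ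
  | .bit false => 0
  | .bit true => 1
  | .node => 2
  | .sep => 3
  | .endGraph => 4
  | .edge .one => 5
  | .edge .opt => 6
  | .edge .plus => 7
  | .edge .star => 8

/-- The list of all symbols. -/
def allSymbols : List GSymbol :=
  [.bit false, .bit true, .node, .sep, .endGraph, .edge .one, .edge .opt, .edge .plus, .edge .star]

theorem mem_allSymbols (g : GSymbol) : g ∈ allSymbols := by
  rcases g with (_ | _) | _ | (_ | _ | _ | _) | _ | _ <;> decide

instance : Enc GSymbol where
  enc g := unary (symbolIndex g)
  enc_injective := by
    intro g h hgh
    have := unary_injective hgh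
    rcases g with (_ | _) | _ | (_ | _ | _ | _) | _ | _ <;>
      rcases h with (_ | _) | _ | (_ | _ | _ | _) | _ | _ <;> simp_all [symbolIndex]

theorem sz_symbol (g : GSymbol) : sz g ≤ 17 := by
  rcases g with (_ | _) | _ | (_ | _ | _ | _) | _ | _ <;> decide

theorem sz_symbols (w : List GSymbol) : sz w ≤ 18 * w.length + 1 := by
  induction w with
  | nil => simp
  | cons g w ih =>
    have := sz_symbol g
    simp only [sz_cons, List.length_cons]
    omega

/-- Push the code of the symbol in the control store, if it is in the list. -/
def pushSymbol : List GSymbol → Cmd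
  | [] => .basic []
  | g :: l => .ite (fun v => v.sym = some g) (.basic ((enc g).code.reverse.map (pushC .a)))
      (pushSymbol l)

theorem foldl_pushC (l : List Bool) (v : Ctl) (a : List Bool) (i : List GSymbol) :
    (l.map (pushC .a)).foldl (fun m i => i.eval m) ⟨v, tapes a [] [] [] [], i⟩ =
      ⟨v, tapes (l.reverse ++ a) [] [] [] [], i⟩ := by
  induction l generalizing a with
  | nil => rfl
  | cons z l ih =>
    rw [List.map_cons, List.foldl_cons,
      show (pushC .a z).eval ⟨v, tapes a [] [] [] [], i⟩ = ⟨v, tapes (z :: a) [] [] [] [], i⟩ by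
        simp [pushC, Instr.eval], ih]
    simp

theorem pushSymbol_runs {v : Ctl} {g : GSymbol} (hv : v.sym = some g) (a : List Bool)
    (i : List GSymbol) (l : List GSymbol) (hg : g ∈ l) :
    Runs (pushSymbol l) ⟨v, tapes a [] [] [] [], i⟩ ⟨v, tapes ((enc g).code ++ a) [] [] [] [], i⟩
      (l.length + 1) := by
  induction l with
  | nil => simp at hg
  | cons h l ih =>
    by_cases hgh : g = h
    · subst hgh
      refine .ite_true (by simp [hv]) (.basic ?_ le_rfl) (by simp)
      rw [foldl_pushC, List.reverse_reverse]
    · refine .ite_false (by simpa [hv] using hgh) (ih ((List.mem_cons.1 hg).resolve_left hgh)) ?_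
      simp only [List.length_cons]
      omega

/-- Read a symbol into the control store. -/
def readSym : Instr := .read fun v o => { v with sym := o }

/-- Read the input. -/
def readLoop : Cmd :=
  .loop (fun v => v.sym.isSome) (.seq (pushSymbol allSymbols) (.basic [pushC .a true, readSym]))

theorem readLoop_runs (w : List GSymbol) : ∀ acc : List GSymbol,
    Runs readLoop ⟨⟨none, none, false, w.head?⟩, tapes (enc acc).code [] [] [] [], w.tail⟩
      ⟨Ctl.start, tapes (enc (w.reverse ++ acc)).code [] [] [] [], []⟩ (12 * w.length + 1) := by
  induction w with
  | nil => exact fun acc => .loop_false rfl le_rfl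
  | cons g w ih =>
    intro acc
    refine .loop_true rfl (.seq (pushSymbol_runs rfl _ _ _ (mem_allSymbols g)) (.basic rfl le_rfl)
      le_rfl) (((ih (g :: acc)).congr_left ?_).congr_right ?_) (T₂ := 12 * w.length + 1) ?_
    · simp [pushC, readSym, Instr.eval, enc_cons, code]
    · simp
    · simp only [List.length_cons, allSymbols, List.length_nil]
      omega

/-- Write the top truth value to the stack `b` and clear the memory. -/
def writeOutput : Cmd :=
  .basic [popX .a, .push .b fun v => v.x.getD false, popX .a, popX .a, reset]

/-- A function computable in polynomial time on the tree stack is computed in polynomial time by a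
Turing machine. -/
theorem PolyTime.nonempty {f : List GSymbol → Bool} (hf : PolyTime f) :
    Nonempty (Turing.TM2ComputableInPolyTime (id : List GSymbol → List GSymbol)
      Computability.encodeBool f) := by
  obtain ⟨p, P, hp⟩ := hf.comp (PolyTime.reverse .self)
  refine nonempty_polyTime (.seq (.basic [pushC .a false, readSym]) (.seq readLoop
    (.seq p writeOutput))) (P.comp (18 * .X + 1) + 12 * .X + 3) fun w => ?_
  have h1 := (hp w.reverse).1 []
  simp only [List.reverse_reverse, List.append_nil] at h1
  have h2 := readLoop_runs w []
  rw [List.append_nil] at h2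
  refine Runs.seq (.basic rfl le_rfl) (.seq (h2.congr_left ?_) (.seq h1 (.basic ?_ le_rfl) le_rfl)
    le_rfl) ?_
  · refine Mem.ext rfl (funext fun k => ?_) rfl
    cases k <;> rfl
  · refine Mem.ext rfl (funext fun k => ?_) rfl
    cases f w <;> cases k <;> simp [popX, reset, Instr.eval, mem, outputMem, enc, ofBool, code]
  · have h3 := eval_mono P ((sz_symbols w.reverse).trans_eq (by rw [List.length_reverse]))
    simp only [Polynomial.eval_add, Polynomial.eval_mul, Polynomial.eval_ofNat,
      Polynomial.eval_X, Polynomial.eval_comp, Polynomial.eval_one]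
    omega

end StackProg

open StackProg StackProg.Enc

/-! ### Codes of graphs -/

/-- A number for each basic interval. -/
def BasicInterval.index : BasicInterval → ℕ
  | .one => 0
  | .opt => 1
  | .plus => 2
  | .star => 3

instance : Enc BasicInterval where
  enc I := unary I.index
  enc_injective := by
    intro I J h
    have := unary_injective h
    cases I <;> cases J <;> simp_all [BasicInterval.index]

/-- The components of an edge. -/
def EdgeCode.toProd (e : EdgeCode) : BWord × BWord × BasicInterval × BWord :=
  (e.src, e.lab, e.occ, e.tgt)

instance : Enc EdgeCode where
  enc e := enc e.toProd
  enc_injective := by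
    rintro ⟨⟩ ⟨⟩ h
    have := enc_injective h
    simp_all [EdgeCode.toProd]

instance : Enc GraphCode where
  enc c := enc (c.nodes, c.edges)
  enc_injective := by
    rintro ⟨⟩ ⟨⟩ h
    have := enc_injective h
    simp_all

namespace StackProg

variable {α β γ δ : Type} [Enc α] [Enc β] [Enc γ] [Enc δ]

theorem PolyTime.fst' {f : γ → α × β} (hf : PolyTime f) : PolyTime fun x => (f x).1 :=
  PolyTime.fst.comp hf

theorem PolyTime.snd' {f : γ → α × β} (hf : PolyTime f) : PolyTime fun x => (f x).2 :=
  PolyTime.snd.comp hf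

theorem PolyTime.edgeToProd {f : γ → EdgeCode} (hf : PolyTime f) :
    PolyTime fun x => (f x).toProd :=
  hf.of_enc_eq (fun x => x) (fun _ => rfl) fun _ => rfl

theorem PolyTime.src {f : γ → EdgeCode} (hf : PolyTime f) : PolyTime fun x => (f x).src :=
  hf.edgeToProd.fst'

theorem PolyTime.lab {f : γ → EdgeCode} (hf : PolyTime f) : PolyTime fun x => (f x).lab :=
  hf.edgeToProd.snd'.fst'

theorem PolyTime.occ {f : γ → EdgeCode} (hf : PolyTime f) : PolyTime fun x => (f x).occ :=
  hf.edgeToProd.snd'.snd'.fst'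

theorem PolyTime.tgt {f : γ → EdgeCode} (hf : PolyTime f) : PolyTime fun x => (f x).tgt :=
  hf.edgeToProd.snd'.snd'.snd'

theorem PolyTime.mkEdge {s l t : γ → BWord} {o : γ → BasicInterval} (hs : PolyTime s)
    (hl : PolyTime l) (ho : PolyTime o) (ht : PolyTime t) :
    PolyTime fun x => (⟨s x, l x, o x, t x⟩ : EdgeCode) :=
  (hs.pair (hl.pair (ho.pair ht))).of_enc_eq (fun x => x) (fun _ => rfl) fun _ => rfl

theorem PolyTime.graphToProd {f : γ → GraphCode} (hf : PolyTime f) :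
    PolyTime fun x => ((f x).nodes, (f x).edges) :=
  hf.of_enc_eq (fun x => x) (fun _ => rfl) fun _ => rfl

theorem PolyTime.nodes {f : γ → GraphCode} (hf : PolyTime f) : PolyTime fun x => (f x).nodes :=
  hf.graphToProd.fst'

theorem PolyTime.edges {f : γ → GraphCode} (hf : PolyTime f) : PolyTime fun x => (f x).edges :=
  hf.graphToProd.snd'

theorem PolyTime.mkGraph {n : γ → List BWord} {e : γ → List EdgeCode} (hn : PolyTime n)
    (he : PolyTime e) : PolyTime fun x => (⟨n x, e x⟩ : GraphCode) :=
  (hn.pair he).of_enc_eq (fun x => x) (fun _ => rfl) fun _ => rfl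

theorem PolyTime.nodeNames {f : γ → GraphCode} (hf : PolyTime f) :
    PolyTime fun x => (f x).nodeNames :=
  .append hf.nodes (.flatMap (f := fun _ e => [e.src, e.tgt]) hf.edges
    (.cons PolyTime.self.snd'.src (.cons PolyTime.self.snd'.tgt (.const []))))

end StackProg

/-! ### The tests -/

/-- No two entries have the same source and label. -/
def detTest (l : List EdgeCode) : Bool :=
  l.all fun e => (l.filter fun f => decide (f.src = e.src) && decide (f.lab = e.lab)).tail.isEmpty

/-- No entry has the interval `+`. -/
def noPlusTest (l : List EdgeCode) : Bool :=
  l.all fun e => !decide (e.occ = .plus)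

/-- The node `x` is referenced by one of the edges. -/
def isTarget (l : List EdgeCode) (x : BWord) : Bool :=
  l.any fun f => decide (f.tgt = x)

/-- The edges that are not `*`-closed. -/
def openEdges (l : List EdgeCode) : List EdgeCode :=
  gfp (fun X e => !decide (e.occ = .star) && (!isTarget l e.src || isTarget X e.src)) l

/-- Sources of `?`-edges are referenced, and by `*`-closed references only. -/
def optTest (l : List EdgeCode) : Bool :=
  l.all fun e => !decide (e.occ = .opt) ||
    (isTarget l e.src && !isTarget (openEdges l) e.src)

/-- The test for `DetShEx₀⁻`. -/
def classTest (l : List EdgeCode) : Bool :=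
  detTest l && (noPlusTest l && optTest l)

/-- Inclusion of basic intervals. -/
def BasicInterval.le : BasicInterval → BasicInterval → Bool
  | _, .star => true
  | .one, _ => true
  | .opt, .opt => true
  | .plus, .plus => true
  | _, _ => false

/-- Basic intervals that contain zero. -/
def BasicInterval.hasZero : BasicInterval → Bool
  | .opt => true
  | .star => true
  | _ => false

/-- The local condition for a pair of nodes in a simulation. -/
def localTest (h k : List EdgeCode) (X : List (BWord × BWord)) (q : BWord × BWord) : Bool :=
  (h.all fun e => !decide (e.src = q.1) || k.any fun f => decide (f.src = q.2) &&
    (decide (e.lab = f.lab) && (e.occ.le f.occ && X.any fun r => decide (r = (e.tgt, f.tgt))))) &&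
  k.all fun f => !decide (f.src = q.2) || (f.occ.hasZero ||
    h.any fun e => decide (e.src = q.1) && decide (e.lab = f.lab))

/-- The greatest simulation. -/
def simPairs (H K : GraphCode) : List (BWord × BWord) :=
  gfp (localTest H.edges K.edges) (H.nodeNames.flatMap fun n => K.nodeNames.map fun m => (n, m))

/-- The test for embedding. -/
def embedTest (H K : GraphCode) : Bool :=
  H.nodeNames.all fun n => (simPairs H K).any fun q => decide (q.1 = n)

namespace StackProg

variable {γ : Type} [Enc γ]

theorem PolyTime.detTest : PolyTime detTest :=
  .all .self (.isEmpty (.tail (.filter PolyTime.self.fst'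
    (.and (.eq PolyTime.self.snd'.src PolyTime.self.fst'.snd'.src)
      (.eq PolyTime.self.snd'.lab PolyTime.self.fst'.snd'.lab)))))

theorem PolyTime.noPlusTest : PolyTime noPlusTest :=
  .all .self (.not (.eq PolyTime.self.snd'.occ (.const _)))

theorem PolyTime.isTarget {l : γ → List EdgeCode} {x : γ → BWord} (hl : PolyTime l)
    (hx : PolyTime x) : PolyTime fun y => isTarget (l y) (x y) :=
  .any hl (.eq PolyTime.self.snd'.tgt (hx.comp PolyTime.self.fst'))

theorem PolyTime.openEdges : PolyTime openEdges := by
  have h : PolyTime fun q : (List EdgeCode × List EdgeCode) × EdgeCode =>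
      !decide (q.2.occ = .star) && (!_root_.isTarget q.1.1 q.2.src || _root_.isTarget q.1.2 q.2.src) :=
    .and (.not (.eq PolyTime.self.snd'.occ (.const _)))
      (.or (.not (.isTarget PolyTime.self.fst'.fst' PolyTime.self.snd'.src))
        (.isTarget PolyTime.self.fst'.snd' PolyTime.self.snd'.src))
  exact (PolyTime.gfp (l := fun l => l) (p := fun l X e => !decide (e.occ = .star) &&
    (!_root_.isTarget l e.src || _root_.isTarget X e.src)) .self h).congr fun _ => rfl

theorem PolyTime.optTest : PolyTime optTest :=
  .all .self (.or (.not (.eq PolyTime.self.snd'.occ (.const _)))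
    (.and (.isTarget PolyTime.self.fst' PolyTime.self.snd'.src)
      (.not (.isTarget (PolyTime.openEdges.comp PolyTime.self.fst') PolyTime.self.snd'.src))))

theorem PolyTime.classTest : PolyTime classTest :=
  .and .detTest (.and .noPlusTest .optTest)

instance : Nonempty BasicInterval := ⟨.one⟩

theorem PolyTime.le {I J : γ → BasicInterval} (hI : PolyTime I) (hJ : PolyTime J) :
    PolyTime fun x => (I x).le (J x) :=
  .switch (c := fun x => (I x, J x)) (f := fun a _ => a.1.le a.2) (.pair hI hJ) fun _ => .const _

theorem PolyTime.hasZero {I : γ → BasicInterval} (hI : PolyTime I) :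
    PolyTime fun x => (I x).hasZero :=
  .switch (c := I) (f := fun a _ => a.hasZero) hI fun _ => .const _

theorem PolyTime.localTest {h k : γ → List EdgeCode} {X : γ → List (BWord × BWord)}
    {q : γ → BWord × BWord} (hh : PolyTime h) (hk : PolyTime k) (hX : PolyTime X)
    (hq : PolyTime q) : PolyTime fun x => localTest (h x) (k x) (X x) (q x) := by
  refine .and (.all hh (.or (.not (.eq PolyTime.self.snd'.src
    (hq.comp PolyTime.self.fst').fst')) (.any (hk.comp PolyTime.self.fst') (.and
      (.eq PolyTime.self.snd'.src (hq.comp PolyTime.self.fst'.fst').snd')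
      (.and (.eq PolyTime.self.fst'.snd'.lab PolyTime.self.snd'.lab)
        (.and (.le PolyTime.self.fst'.snd'.occ PolyTime.self.snd'.occ)
          (.any (hX.comp PolyTime.self.fst'.fst') (.eq PolyTime.self.snd'
            (.pair PolyTime.self.fst'.fst'.snd'.tgt PolyTime.self.fst'.snd'.tgt)))))))))
    (.all hk (.or (.not (.eq PolyTime.self.snd'.src (hq.comp PolyTime.self.fst').snd'))
      (.or (.hasZero PolyTime.self.snd'.occ) (.any (hh.comp PolyTime.self.fst') (.and
        (.eq PolyTime.self.snd'.src (hq.comp PolyTime.self.fst'.fst').fst')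
        (.eq PolyTime.self.snd'.lab PolyTime.self.fst'.snd'.lab))))))

theorem PolyTime.simPairs : PolyTime fun x : GraphCode × GraphCode => simPairs x.1 x.2 := by
  have h : PolyTime fun q : ((GraphCode × GraphCode) × List (BWord × BWord)) × (BWord × BWord) =>
      _root_.localTest q.1.1.1.edges q.1.1.2.edges q.1.2 q.2 :=
    .localTest PolyTime.self.fst'.fst'.fst'.edges PolyTime.self.fst'.fst'.snd'.edges
      PolyTime.self.fst'.snd' PolyTime.self.snd'
  have h' : PolyTime fun x : GraphCode × GraphCode =>
      x.1.nodeNames.flatMap fun n => x.2.nodeNames.map fun m => (n, m) :=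
    .flatMap (f := fun (x : GraphCode × GraphCode) n => x.2.nodeNames.map fun m => (n, m)) PolyTime.self.fst'.nodeNames
      (.map (f := fun (x : (GraphCode × GraphCode) × BWord) m => (x.2, m)) PolyTime.self.fst'.snd'.nodeNames
        (.pair PolyTime.self.fst'.snd' PolyTime.self.snd'))
  exact (PolyTime.gfp (p := fun x X q => _root_.localTest x.1.edges x.2.edges X q) h' h).congr
    fun _ => rfl

theorem PolyTime.embedTest : PolyTime fun x : GraphCode × GraphCode => embedTest x.1 x.2 :=
  .all PolyTime.self.fst'.nodeNames (.any (PolyTime.simPairs.comp PolyTime.self.fst')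
    (.eq PolyTime.self.snd'.fst' PolyTime.self.fst'.snd'))

end StackProg

/-! ### Correctness of the tests -/

namespace GraphCode

variable (c : GraphCode)

theorem isDeterministic_iff : c.toGraph.IsDeterministic ↔ detTest c.edges = true := by
  let k : EdgeCode → BWord × BWord := fun e => (e.src, e.lab)
  have h1 : c.toGraph.IsDeterministic ↔ (c.edges.map k).Nodup := by
    rw [List.Nodup, List.pairwise_map, List.pairwise_iff_get]
    constructor
    · intro h i j hij he
      simp only [k, Prod.mk.injEq] at he
      exact hij.ne (h i j (Subtype.ext he.1) he.2)
    · intro h (i : Fin c.edges.length) (j : Fin c.edges.length) hs hl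
      have hs' := congrArg Subtype.val hs
      have he : k (c.edges.get i) = k (c.edges.get j) := Prod.ext hs' hl
      rcases lt_trichotomy i j with hij | hij | hij
      · exact absurd he (h i j hij)
      · exact hij
      · exact absurd he.symm (h j i hij)
  rw [h1, List.nodup_iff_count_le_one]
  simp only [detTest, List.all_eq_true, List.isEmpty_iff]
  have h2 : ∀ e, (c.edges.filter fun f => decide (f.src = e.src) && decide (f.lab = e.lab)).length =
      (c.edges.map k).count (k e) := by
    intro e
    rw [List.count, List.countP_map, List.countP_eq_length_filter]
    congr 2
    funext f
    rw [Bool.eq_iff_iff]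
    simp [k]
  have h3 : ∀ l : List EdgeCode, l.tail = [] ↔ l.length ≤ 1 := by
    intro l
    rw [← List.length_eq_zero_iff, List.length_tail]
    omega
  simp only [h3, h2]
  refine ⟨fun h e _ => h _, fun h a => ?_⟩
  by_cases ha : a ∈ c.edges.map k
  · obtain ⟨e, he, rfl⟩ := List.mem_map.1 ha
    exact h e he
  · rw [List.count_eq_zero_of_not_mem ha]
    exact Nat.zero_le _

theorem occur_eq_iff (i : Fin c.edges.length) (I : BasicInterval) :
    c.toGraph.occur i = I.toInterval ↔ (c.edges.get i).occ = I :=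
  BasicInterval.toInterval_injective.eq_iff

theorem target_eq_source_iff (i j : Fin c.edges.length) :
    c.toGraph.target i = c.toGraph.source j ↔ (c.edges.get i).tgt = (c.edges.get j).src :=
  Subtype.ext_iff

theorem isTarget_iff (l : List EdgeCode) (x : BWord) :
    isTarget l x = true ↔ ∃ e ∈ l, e.tgt = x := by
  simp [isTarget]

theorem exists_target_iff (j : Fin c.edges.length) :
    (∃ i, c.toGraph.target i = c.toGraph.source j) ↔
      isTarget c.edges (c.edges.get j).src = true := by
  rw [isTarget_iff]
  constructor
  · rintro ⟨i, hi⟩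
    exact ⟨_, List.get_mem _ i, (c.target_eq_source_iff i j).1 hi⟩
  · rintro ⟨e, he, ht⟩
    obtain ⟨i, rfl⟩ := List.mem_iff_get.1 he
    exact ⟨i, (c.target_eq_source_iff i j).2 ht⟩

theorem starClosed_iff (i : Fin c.edges.length) :
    c.toGraph.StarClosed i ↔ c.edges.get i ∉ openEdges c.edges := by
  have key : ∀ i : c.toGraph.Edge, c.toGraph.StarClosed i →
      c.edges.get (i : Fin c.edges.length) ∉ openEdges c.edges := by
    intro i h
    induction h with
    | star i hi =>
      intro hmem
      have := of_mem_gfp hmem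
      simp [(c.occur_eq_iff i _).1 hi] at this
    | step i hne hall ih =>
      intro hmem
      have h1 := of_mem_gfp hmem
      rw [(c.exists_target_iff i).1 hne] at h1
      simp only [Bool.not_true, Bool.false_or, Bool.and_eq_true, isTarget_iff] at h1
      obtain ⟨e, he, ht⟩ := h1.2
      obtain ⟨j, rfl⟩ := List.mem_iff_get.1 (mem_of_mem_gfp he)
      exact ih j ((c.target_eq_source_iff j i).2 ht) he
  refine ⟨key i, Function.mtr fun h => not_not.2 ?_⟩
  · refine mem_gfp (fun e => ∃ j, c.edges.get j = e ∧ ¬ c.toGraph.StarClosed j) ?_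
      (List.get_mem _ i) ⟨i, rfl, h⟩
    rintro X hX _ - ⟨j, rfl, hj⟩
    have hocc : (c.edges.get j).occ ≠ .star := fun ho =>
      hj (LGraph.StarClosed.star (H := c.toGraph) j ((c.occur_eq_iff j _).2 ho))
    simp only [hocc, decide_false, Bool.not_false, Bool.true_and, Bool.or_eq_true]
    by_cases hne : ∃ i, c.toGraph.target i = c.toGraph.source j
    · right
      by_contra hno
      refine hj (LGraph.StarClosed.step (H := c.toGraph) j hne fun i hi => ?_)
      by_contra hi'
      exact hno ((isTarget_iff _ _).2 ⟨_, hX _ (List.get_mem _ i) ⟨i, rfl, hi'⟩,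
        (c.target_eq_source_iff i j).1 hi⟩)
    · left
      rw [c.exists_target_iff] at hne
      simpa using hne

theorem isDetShExZeroMinus_iff : c.toGraph.IsDetShExZeroMinus ↔ classTest c.edges = true := by
  have hplus : (∀ i, c.toGraph.occur i ≠ BasicInterval.plus.toInterval) ↔
      noPlusTest c.edges = true := by
    simp only [noPlusTest, List.all_eq_true, Bool.not_eq_true', decide_eq_false_iff_not]
    constructor
    · intro h e he
      obtain ⟨i, rfl⟩ := List.mem_iff_get.1 he
      exact fun ho => h i ((c.occur_eq_iff i _).2 ho)
    · exact fun h i ho => h _ (List.get_mem _ i) ((c.occur_eq_iff i _).1 ho)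
  have hopt : (∀ t, (∃ e, c.toGraph.source e = t ∧
      c.toGraph.occur e = BasicInterval.opt.toInterval) → (∃ e, c.toGraph.target e = t) ∧
        ∀ e, c.toGraph.target e = t → c.toGraph.StarClosed e) ↔ optTest c.edges = true := by
    simp only [optTest, List.all_eq_true, Bool.or_eq_true, Bool.and_eq_true, Bool.not_eq_true',
      decide_eq_false_iff_not]
    constructor
    · intro h e he
      obtain ⟨i, rfl⟩ := List.mem_iff_get.1 he
      refine or_iff_not_imp_left.2 fun ho => ?_
      obtain ⟨h1, h2⟩ := h _ ⟨i, rfl, (c.occur_eq_iff i _).2 (not_not.1 ho)⟩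
      refine ⟨(c.exists_target_iff i).1 h1, ?_⟩
      rw [← Bool.not_eq_true, isTarget_iff]
      rintro ⟨f, hf, ht⟩
      obtain ⟨j, rfl⟩ := List.mem_iff_get.1 (mem_of_mem_gfp hf)
      exact (c.starClosed_iff j).1 (h2 j ((c.target_eq_source_iff j i).2 ht)) hf
    · rintro h _ ⟨i, rfl, ho⟩
      obtain ⟨h1, h2⟩ := (h _ (List.get_mem _ i)).resolve_left
        (not_not.2 ((c.occur_eq_iff i _).1 ho))
      refine ⟨(c.exists_target_iff i).2 h1, fun j hj => (c.starClosed_iff j).2 fun hmem => ?_⟩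
      rw [← Bool.not_eq_true, isTarget_iff] at h2
      exact h2 ⟨_, hmem, (c.target_eq_source_iff j i).1 hj⟩
  rw [classTest, Bool.and_eq_true, Bool.and_eq_true, ← hplus, ← hopt, ← c.isDeterministic_iff]
  exact ⟨fun h => ⟨h.deterministic, h.no_plus, h.opt_closed⟩,
    fun h => ⟨fun i => ⟨_, rfl⟩, h.1, h.2.1, h.2.2⟩⟩

end GraphCode

theorem BasicInterval.toSet_subset_iff (I J : BasicInterval) :
    I.toInterval.toSet ⊆ J.toInterval.toSet ↔ I.le J = true := by
  rw [OccInterval.toSet_subset_iff]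
  cases I <;> cases J <;> simp [BasicInterval.toInterval, BasicInterval.le]

theorem BasicInterval.zero_mem_iff (I : BasicInterval) :
    0 ∈ I.toInterval.toSet ↔ I.hasZero = true := by
  rw [OccInterval.zero_mem_toSet_iff]
  cases I <;> simp [BasicInterval.toInterval, BasicInterval.hasZero]

theorem localTest_iff {H K : GraphCode} {X : List (BWord × BWord)}
    {R : H.toGraph.Node → K.toGraph.Node → Prop} (hR : ∀ n m, R n m ↔ (n.1, m.1) ∈ X)
    (n : H.toGraph.Node) (m : K.toGraph.Node) :
    LGraph.DetLocal H.toGraph K.toGraph R n m ↔ localTest H.edges K.edges X (n.1, m.1) = true := by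
  simp only [localTest, Bool.and_eq_true, List.all_eq_true, Bool.or_eq_true, Bool.not_eq_true',
    decide_eq_false_iff_not, List.any_eq_true, decide_eq_true_eq, exists_eq_right,
    ← BasicInterval.toSet_subset_iff, ← BasicInterval.zero_mem_iff]
  refine and_congr ⟨fun h e he => ?_, fun h i hi => ?_⟩ ⟨fun h f hf => ?_, fun h j hj => ?_⟩
  · obtain ⟨i, rfl⟩ := List.mem_iff_get.1 he
    refine or_iff_not_imp_left.2 fun hs => ?_
    obtain ⟨j, h1, h2, h3, h4⟩ := h i (Subtype.ext (not_not.1 hs))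
    exact ⟨_, List.get_mem _ j, congrArg Subtype.val h1, h2, h4, (hR _ _).1 h3⟩
  · obtain ⟨f, hf, h1, h2, h3, h4⟩ := (h _ (List.get_mem _ i)).resolve_left
      (not_not.2 (congrArg Subtype.val hi))
    obtain ⟨j, rfl⟩ := List.mem_iff_get.1 hf
    exact ⟨j, Subtype.ext h1, h2, (hR _ _).2 h4, h3⟩
  · obtain ⟨j, rfl⟩ := List.mem_iff_get.1 hf
    refine or_iff_not_imp_left.2 fun hs => ?_
    refine (h j (Subtype.ext (not_not.1 hs))).imp (fun h => h) ?_
    rintro ⟨i, h1, h2⟩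
    exact ⟨_, List.get_mem _ i, congrArg Subtype.val h1, h2⟩
  · refine ((h _ (List.get_mem _ j)).resolve_left
      (not_not.2 (congrArg Subtype.val hj))).imp (fun h => h) ?_
    rintro ⟨e, he, h1, h2⟩
    obtain ⟨i, rfl⟩ := List.mem_iff_get.1 he
    exact ⟨i, Subtype.ext h1, h2⟩

theorem localTest_mono {h k : List EdgeCode} {X Y : List (BWord × BWord)} {q : BWord × BWord}
    (hXY : ∀ r ∈ X, r ∈ Y) (hX : localTest h k X q = true) : localTest h k Y q = true := by
  simp only [localTest, Bool.and_eq_true, List.all_eq_true, Bool.or_eq_true, List.any_eq_true,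
    decide_eq_true_eq, exists_eq_right] at hX ⊢
  refine ⟨fun e he => (hX.1 e he).imp (fun h => h) ?_, hX.2⟩
  rintro ⟨f, hf, h1, h2, h3, h4⟩
  exact ⟨f, hf, h1, h2, h3, hXY _ h4⟩

theorem mem_pairs_iff (H K : GraphCode) (q : BWord × BWord) :
    (q ∈ H.nodeNames.flatMap fun n => K.nodeNames.map fun m => (n, m)) ↔
      q.1 ∈ H.nodeNames ∧ q.2 ∈ K.nodeNames := by
  obtain ⟨a, b⟩ := q
  simp only [List.mem_flatMap, List.mem_map, Prod.mk.injEq]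
  constructor
  · rintro ⟨n, hn, m, hm, rfl, rfl⟩
    exact ⟨hn, hm⟩
  · rintro ⟨ha, hb⟩
    exact ⟨a, ha, b, hb, rfl, rfl⟩

theorem embeds_iff {H K : GraphCode} (hH : H.toGraph.IsDeterministic)
    (hK : K.toGraph.IsDeterministic) :
    H.toGraph.Embeds K.toGraph ↔ embedTest H K = true := by
  simp only [embedTest, List.all_eq_true, List.any_eq_true, decide_eq_true_eq]
  constructor
  · rintro ⟨R, hR, hd⟩ n hn
    rw [LGraph.isSimulation_iff_of_deterministic hH hK] at hR
    obtain ⟨m, hm⟩ := hd ⟨n, hn⟩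
    refine ⟨(n, m.1), mem_gfp (fun q => ∃ (h1 : q.1 ∈ H.nodeNames) (h2 : q.2 ∈ K.nodeNames), R ⟨q.1, h1⟩ ⟨q.2, h2⟩) ?_
      ((mem_pairs_iff H K _).2 ⟨hn, m.2⟩) ⟨hn, m.2, hm⟩, rfl⟩
    rintro X hX ⟨a, b⟩ - ⟨ha, hb, hab⟩
    classical
    let Y : List (BWord × BWord) := (H.nodeNames.flatMap fun n => K.nodeNames.map fun m =>
      (n, m)).filter fun q => ∃ (h1 : q.1 ∈ H.nodeNames) (h2 : q.2 ∈ K.nodeNames), R ⟨q.1, h1⟩ ⟨q.2, h2⟩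
    refine localTest_mono (X := Y) (fun r hr => ?_)
      ((localTest_iff (R := R) (X := Y) (fun n m => ?_) ⟨a, ha⟩ ⟨b, hb⟩).1 (hR _ _ hab))
    · obtain ⟨h1, h2⟩ := List.mem_filter.1 hr
      exact hX r h1 (by simpa using h2)
    · rw [List.mem_filter, mem_pairs_iff, decide_eq_true_eq]
      exact ⟨fun h => ⟨⟨n.2, m.2⟩, n.2, m.2, h⟩, fun ⟨_, _, _, h⟩ => h⟩
  · intro h
    refine ⟨fun n m => (n.1, m.1) ∈ simPairs H K,
      (LGraph.isSimulation_iff_of_deterministic hH hK _).2 fun n m hnm => ?_, fun n => ?_⟩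
    · exact (localTest_iff (fun _ _ => Iff.rfl) n m).2 (of_mem_gfp hnm)
    · obtain ⟨q, hq, hqn⟩ := h n.1 n.2
      have hm := (mem_pairs_iff H K q).1 (mem_of_mem_gfp hq)
      have hq' : (n.1, q.2) = q := Prod.ext hqn.symm rfl
      exact ⟨⟨q.2, hm.2⟩, show (n.1, q.2) ∈ simPairs H K from hq'.symm ▸ hq⟩

/-! ### Parsing -/

/-- The state of the parser, which reads the input from the right: the current word, the completed
words of the current entry, and the graphs to the right. -/
abbrev ParseState : Type := BWord × List BWord × List GraphCode

/-- Parse one symbol. -/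
def parseSymbol : GSymbol → ParseState → Option ParseState
  | .bit b, (cur, ws, gs) => some (b :: cur, ws, gs)
  | .sep, (cur, ws, gs) => some ([], cur :: ws, gs)
  | .node, (cur, [], g :: gs) => some ([], [], ⟨cur :: g.nodes, g.edges⟩ :: gs)
  | .edge M, (cur, [l, t], ⟨[], es⟩ :: gs) => some ([], [], ⟨[], ⟨cur, l, M, t⟩ :: es⟩ :: gs)
  | .endGraph, ([], [], gs) => some ([], [], ⟨[], []⟩ :: gs)
  | _, _ => none

/-- Continue parsing with the words to the left. -/
def parseFrom (s : Option ParseState) (w : List GSymbol) : Option ParseState :=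
  w.foldr (fun g s => s.bind (parseSymbol g)) s

/-- The input that has been read in a state of the parser. -/
def ParseState.render (s : ParseState) : List GSymbol :=
  encodeWord s.1 ++ (s.2.1.flatMap (fun x => .sep :: encodeWord x) ++
    s.2.2.flatMap GraphCode.encode)

theorem render_parseSymbol {g : GSymbol} {s s' : ParseState} (h : parseSymbol g s = some s') :
    s'.render = g :: s.render := by
  unfold parseSymbol at h
  split at h <;> simp only [Option.some.injEq, reduceCtorEq] at h <;> subst h <;>
    simp [ParseState.render, encodeWord, GraphCode.encode, encodeNode, EdgeCode.encode]

theorem render_parseFrom (w : List GSymbol) {s s' : ParseState}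
    (h : parseFrom (some s) w = some s') : s'.render = w ++ s.render := by
  induction w generalizing s' with
  | nil =>
    obtain rfl : s = s' := by simpa [parseFrom] using h
    rfl
  | cons g w ih =>
    obtain ⟨t, ht, hs⟩ := Option.bind_eq_some_iff.1 h
    rw [render_parseSymbol hs, ih ht, List.cons_append]

theorem parseFrom_append (s : Option ParseState) (v w : List GSymbol) :
    parseFrom s (v ++ w) = parseFrom (parseFrom s w) v :=
  List.foldr_append

theorem parseFrom_cons (s : Option ParseState) (g : GSymbol) (w : List GSymbol) :
    parseFrom s (g :: w) = (parseFrom s w).bind (parseSymbol g) := rfl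

theorem parseFrom_word (x cur : BWord) (ws : List BWord) (gs : List GraphCode) :
    parseFrom (some (cur, ws, gs)) (encodeWord x) = some (x ++ cur, ws, gs) := by
  induction x with
  | nil => rfl
  | cons b x ih =>
    change parseFrom _ (.bit b :: encodeWord x) = _
    rw [parseFrom_cons, ih]
    rfl

theorem parseFrom_edges (l : List EdgeCode) (es : List EdgeCode) (gs : List GraphCode) :
    parseFrom (some ([], [], ⟨[], es⟩ :: gs)) (l.flatMap EdgeCode.encode) =
      some ([], [], ⟨[], l ++ es⟩ :: gs) := by
  induction l with
  | nil => rfl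
  | cons e l ih =>
    rw [List.flatMap_cons, parseFrom_append, ih, EdgeCode.encode, parseFrom_cons,
      parseFrom_append, parseFrom_cons, parseFrom_append, parseFrom_cons, parseFrom_word]
    simp only [Option.bind_some, parseSymbol, parseFrom_word, List.append_nil]
    rfl

theorem parseFrom_nodes (l ns : List BWord) (es : List EdgeCode) (gs : List GraphCode) :
    parseFrom (some ([], [], ⟨ns, es⟩ :: gs)) (l.flatMap encodeNode) =
      some ([], [], ⟨l ++ ns, es⟩ :: gs) := by
  induction l with
  | nil => rfl
  | cons x l ih =>
    rw [List.flatMap_cons, parseFrom_append, ih, encodeNode, parseFrom_cons, parseFrom_word]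
    simp [parseSymbol]

theorem parseFrom_encode (c : GraphCode) (gs : List GraphCode) :
    parseFrom (some ([], [], gs)) c.encode = some ([], [], c :: gs) := by
  rw [GraphCode.encode, parseFrom_append, parseFrom_append]
  change parseFrom (parseFrom (some ([], [], ⟨[], []⟩ :: gs)) _) _ = _
  rw [parseFrom_edges, parseFrom_nodes, List.append_nil, List.append_nil]

/-- The two graphs in a final state of the parser. -/
def twoGraphs : ParseState → Option (GraphCode × GraphCode)
  | ([], [], [H, K]) => some (H, K)
  | _ => none

/-- Parse a pair of graphs. -/
def parsePair (w : List GSymbol) : Option (GraphCode × GraphCode) :=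
  (parseFrom (some ([], [], [])) w).bind twoGraphs

theorem parsePair_eq_some_iff (w : List GSymbol) (H K : GraphCode) :
    parsePair w = some (H, K) ↔ w = H.encode ++ K.encode := by
  constructor
  · intro h
    obtain ⟨s, hs, h'⟩ := Option.bind_eq_some_iff.1 h
    have := render_parseFrom w hs
    unfold twoGraphs at h'
    split at h'
    · simp only [Option.some.injEq, Prod.mk.injEq] at h'
      obtain ⟨rfl, rfl⟩ := h'
      simpa [ParseState.render, encodeWord] using this.symm
    · simp at h'
  · rintro rfl
    rw [parsePair, parseFrom_append, parseFrom_encode, parseFrom_encode]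
    rfl

/-- The decision procedure for containment. -/
def decideContainment (w : List GSymbol) : Bool :=
  ((parsePair w).map fun x =>
    classTest x.1.edges && (classTest x.2.edges && embedTest x.1 x.2)).getD false

theorem decideContainment_iff (w : List GSymbol) : decideContainment w = true ↔
    w ∈ containmentProblem fun H : LGraph BWord => H.IsDetShExZeroMinus := by
  have key : ∀ H K : GraphCode,
      (classTest H.edges && (classTest K.edges && embedTest H K)) = true ↔
        H.toGraph.IsDetShExZeroMinus ∧ K.toGraph.IsDetShExZeroMinus ∧
          H.toGraph.Contained K.toGraph := by
    intro H K
    rw [Bool.and_eq_true, Bool.and_eq_true, ← H.isDetShExZeroMinus_iff,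
      ← K.isDetShExZeroMinus_iff]
    refine and_congr_right fun hH => and_congr_right fun hK => ?_
    rw [LGraph.contained_iff_embeds hH hK, embeds_iff hH.deterministic hK.deterministic]
  constructor
  · intro h
    cases hp : parsePair w with
    | none => simp [decideContainment, hp] at h
    | some x =>
      obtain ⟨H, K⟩ := x
      simp only [decideContainment, hp, Option.map_some, Option.getD_some] at h
      exact ⟨H, K, (parsePair_eq_some_iff w H K).1 hp, (key H K).1 h⟩
  · rintro ⟨H, K, hw, h⟩
    rw [decideContainment, (parsePair_eq_some_iff w H K).2 hw]
    exact (key H K).2 h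

/-! ### The decision procedure runs in polynomial time -/

namespace StackProg

theorem sz_none {α : Type} [Enc α] : sz (none : Option α) = 1 := rfl

theorem sz_some {α : Type} [Enc α] (a : α) : sz (some a) = sz a + 2 := by
  simp [sz, enc]

theorem sz_graph (c : GraphCode) : sz c = sz c.nodes + sz c.edges + 1 :=
  sz_prod c.nodes c.edges

theorem sz_edge (e : EdgeCode) :
    sz e = sz e.src + (sz e.lab + (sz e.occ + sz e.tgt + 1) + 1) + 1 := by
  rw [← sz_prod, ← sz_prod, ← sz_prod]
  rfl

theorem sz_interval (I : BasicInterval) : sz I ≤ 7 := by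
  cases I <;> decide

theorem sz_parseSymbol (g : GSymbol) (s : ParseState) :
    sz (parseSymbol g s) ≤ sz s + 20 := by
  unfold parseSymbol
  split
  · rename_i b _ _ _
    have := sz_bool b
    simp only [sz_some, sz_prod, sz_cons]
    omega
  · simp only [sz_some, sz_prod, sz_cons, sz_nil]
    omega
  · simp only [sz_some, sz_prod, sz_cons, sz_nil, sz_graph]
    omega
  · rename_i M _ _ _ _ _
    have := sz_interval M
    simp only [sz_some, sz_prod, sz_cons, sz_nil, sz_graph, sz_edge]
    omega
  · simp only [sz_some, sz_prod, sz_cons, sz_nil, sz_graph]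
    omega
  · rw [sz_none]
    omega

instance : Nonempty GSymbol := ⟨.node⟩

theorem PolyTime.parseSymbol_node : PolyTime (parseSymbol .node) := by
  have h : PolyTime fun s : ParseState => parseSymbol .node (s.1, [], s.2.2) := by
    refine .listCases (l := fun s => s.2.2) (f := fun _ => none)
      (g := fun x : ParseState × GraphCode × List GraphCode =>
        some ([], [], ⟨x.1.1 :: x.2.1.nodes, x.2.1.edges⟩ :: x.2.2)) PolyTime.self.snd'.snd'
      (.const _) ?_ ?_ ?_
    · exact .optionSome (.pair (.const _) (.pair (.const _) (.cons (.mkGraph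
        (.cons PolyTime.self.fst'.fst' PolyTime.self.snd'.fst'.nodes) PolyTime.self.snd'.fst'.edges)
        PolyTime.self.snd'.snd')))
    · rintro ⟨cur, ws, gs⟩ hx
      obtain rfl : gs = [] := hx
      rfl
    · rintro ⟨cur, ws, gs⟩ g t hx
      obtain rfl : gs = g :: t := hx
      rfl
  refine .listCases (l := fun s : ParseState => s.2.1)
    (g := fun _ : ParseState × BWord × List BWord => none) PolyTime.self.snd'.fst' h (.const _)
    ?_ ?_
  · rintro ⟨cur, ws, gs⟩ hx
    obtain rfl : ws = [] := hx
    rfl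
  · rintro ⟨cur, ws, gs⟩ a t hx
    obtain rfl : ws = a :: t := hx
    rfl

theorem PolyTime.parseSymbol_endGraph : PolyTime (parseSymbol .endGraph) := by
  refine (PolyTime.ite (c := fun s : ParseState => s.1.isEmpty && s.2.1.isEmpty)
    (f := fun s => some ([], [], ⟨[], []⟩ :: s.2.2)) (g := fun _ => none)
    (.and (.isEmpty .fst) (.isEmpty PolyTime.self.snd'.fst'))
    (.optionSome (.pair (.const _) (.pair (.const _) (.cons (f := fun _ => (⟨[], []⟩ : GraphCode))
      (.const _) PolyTime.self.snd'.snd'))))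
    (.const _)).congr ?_
  rintro ⟨_ | _, _ | _, gs⟩ <;> rfl

theorem PolyTime.parseSymbol_edge (M : BasicInterval) : PolyTime (parseSymbol (.edge M)) := by
  have h1 : PolyTime fun x : BWord × BWord × BWord × GraphCode × List GraphCode =>
      parseSymbol (.edge M) (x.1, [x.2.1, x.2.2.1], x.2.2.2.1 :: x.2.2.2.2) := by
    have h : PolyTime fun x : BWord × BWord × BWord × GraphCode × List GraphCode =>
        (⟨x.1, x.2.1, M, x.2.2.1⟩ : EdgeCode) :=
      .mkEdge PolyTime.self.fst' PolyTime.self.snd'.fst' (.const _) PolyTime.self.snd'.snd'.fst'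
    have h' : PolyTime fun x : BWord × BWord × BWord × GraphCode × List GraphCode =>
        some (([], [], ⟨[], ⟨x.1, x.2.1, M, x.2.2.1⟩ :: x.2.2.2.1.edges⟩ :: x.2.2.2.2) :
          ParseState) :=
      .optionSome (.pair (.const _) (.pair (.const _) (.cons (.mkGraph (.const _) (.cons h
        PolyTime.self.snd'.snd'.snd'.fst'.edges)) PolyTime.self.snd'.snd'.snd'.snd')))
    refine (PolyTime.ite (.isEmpty PolyTime.self.snd'.snd'.snd'.fst'.nodes) h'
      (.const none)).congr ?_
    rintro ⟨cur, l, t, ⟨_ | _, es⟩, gs⟩ <;> rfl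
  have h2 : PolyTime fun x : BWord × BWord × BWord × List GraphCode =>
      parseSymbol (.edge M) (x.1, [x.2.1, x.2.2.1], x.2.2.2) := by
    refine .listCases (l := fun x => x.2.2.2) (f := fun _ => none) PolyTime.self.snd'.snd'.snd'
      (.const _) (h1.comp (.pair (.comp .fst .fst) (.pair PolyTime.self.fst'.snd'.fst'
        (.pair PolyTime.self.fst'.snd'.snd'.fst' .snd)))) ?_ ?_
    · rintro ⟨cur, l, t, gs⟩ hx
      obtain rfl : gs = [] := hx
      rfl
    · rintro ⟨cur, l, t, gs⟩ a u hx
      obtain rfl : gs = a :: u := hx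
      rfl
  have h3 : PolyTime fun x : (ParseState × BWord × List BWord) × BWord × List BWord =>
      parseSymbol (.edge M) (x.1.1.1, x.1.2.1 :: x.2.1 :: x.2.2, x.1.1.2.2) := by
    refine .listCases (l := fun x => x.2.2)
      (g := fun _ : ((ParseState × BWord × List BWord) × BWord × List BWord) ×
        BWord × List BWord => none) PolyTime.self.snd'.snd'
      (h2.comp (.pair PolyTime.self.fst'.fst'.fst' (.pair PolyTime.self.fst'.snd'.fst'
        (.pair PolyTime.self.snd'.fst' PolyTime.self.fst'.fst'.snd'.snd')))) (.const _) ?_ ?_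
    · rintro ⟨⟨⟨cur, ws, gs⟩, l, vs⟩, t, us⟩ hx
      obtain rfl : us = [] := hx
      rfl
    · rintro ⟨⟨⟨cur, ws, gs⟩, l, vs⟩, t, us⟩ a u hx
      obtain rfl : us = a :: u := hx
      rfl
  have h4 : PolyTime fun x : ParseState × BWord × List BWord =>
      parseSymbol (.edge M) (x.1.1, x.2.1 :: x.2.2, x.1.2.2) := by
    refine .listCases (l := fun x => x.2.2) (f := fun _ => none) PolyTime.self.snd'.snd' (.const _)
      h3 ?_ ?_
    · rintro ⟨⟨cur, ws, gs⟩, l, vs⟩ hx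
      obtain rfl : vs = [] := hx
      rfl
    · rintro ⟨⟨cur, ws, gs⟩, l, vs⟩ a u hx
      obtain rfl : vs = a :: u := hx
      rfl
  refine .listCases (l := fun s : ParseState => s.2.1) (f := fun _ => none)
    PolyTime.self.snd'.fst' (.const _) h4 ?_ ?_
  · rintro ⟨cur, ws, gs⟩ hx
    obtain rfl : ws = [] := hx
    rfl
  · rintro ⟨cur, ws, gs⟩ a u hx
    obtain rfl : ws = a :: u := hx
    rfl

theorem PolyTime.parseSymbol (g : GSymbol) : PolyTime (parseSymbol g) := by
  cases g with
  | bit b =>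
    exact (PolyTime.optionSome (f := fun s : ParseState => (b :: s.1, s.2.1, s.2.2))
      (.pair (.cons (.const b) .fst) (.pair PolyTime.self.snd'.fst'
        PolyTime.self.snd'.snd'))).congr fun _ => rfl
  | sep =>
    exact (PolyTime.optionSome (f := fun s : ParseState => ([], s.1 :: s.2.1, s.2.2))
      (.pair (.const _) (.pair (.cons .fst PolyTime.self.snd'.fst')
        PolyTime.self.snd'.snd'))).congr fun _ => rfl
  | node => exact .parseSymbol_node
  | edge M => exact .parseSymbol_edge M
  | endGraph => exact .parseSymbol_endGraph

theorem PolyTime.parse :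
    PolyTime fun w : List GSymbol => parseFrom (some ([], [], [])) w := by
  have h1 : PolyTime fun q : GSymbol × ParseState => _root_.parseSymbol q.1 q.2 :=
    .switch (f := fun g q => _root_.parseSymbol g q.2) .fst fun g =>
      (PolyTime.parseSymbol g).comp (f := fun q : GSymbol × ParseState => q.2) .snd
  have h2 : PolyTime fun q : List GSymbol × Option ParseState × GSymbol =>
      q.2.1.bind (_root_.parseSymbol q.2.2) := by
    refine .optionCases (o := fun q => q.2.1) (f := fun _ => none)
      PolyTime.self.snd'.fst' (.const _)
      (h1.comp (.pair PolyTime.self.fst'.snd'.snd' PolyTime.self.snd')) ?_ ?_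
    · intro q hq
      rw [hq, Option.bind_none]
    · intro q s hq
      rw [hq, Option.bind_some]
  refine (PolyTime.foldl (l := fun w : List GSymbol => w.reverse)
    (init := fun _ => some ([], [], [])) (step := fun _ s g => s.bind (_root_.parseSymbol g))
    (.reverse .self) (.const _) h2 20 fun w s g _ => ?_).congr fun w => ?_
  · cases s with
    | none =>
      rw [Option.bind_none]
      exact Nat.le_add_right _ _
    | some s =>
      have := sz_parseSymbol g s
      rw [Option.bind_some, sz_some, Polynomial.eval_ofNat]
      omega
  · rw [List.foldl_reverse]
    rfl

theorem PolyTime.twoGraphs : PolyTime twoGraphs := by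
  have h1 : PolyTime fun x : GraphCode × GraphCode × List GraphCode =>
      _root_.twoGraphs ([], [], x.1 :: x.2.1 :: x.2.2) := by
    have h : PolyTime fun x : GraphCode × GraphCode × List GraphCode => some (x.1, x.2.1) :=
      .optionSome (.pair PolyTime.self.fst' PolyTime.self.snd'.fst')
    refine (PolyTime.ite (.isEmpty PolyTime.self.snd'.snd') h (.const none)).congr ?_
    rintro ⟨H, K, _ | _⟩ <;> rfl
  have h2 : PolyTime fun x : GraphCode × List GraphCode =>
      _root_.twoGraphs ([], [], x.1 :: x.2) := by
    refine .listCases (l := fun x => x.2) (f := fun _ => none) .snd (.const _)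
      (h1.comp (.pair (.comp .fst .fst) .snd)) ?_ ?_
    · rintro ⟨H, gs⟩ hx
      obtain rfl : gs = [] := hx
      rfl
    · rintro ⟨H, gs⟩ K t hx
      obtain rfl : gs = K :: t := hx
      rfl
  have h3 : PolyTime fun x : List GraphCode => _root_.twoGraphs ([], [], x) := by
    refine .listCases (l := fun x => x) (f := fun _ => none) .self (.const _)
      (h2.comp .snd) ?_ ?_
    · rintro _ rfl
      rfl
    · rintro _ H t rfl
      rfl
  refine (PolyTime.ite (c := fun s : ParseState => s.1.isEmpty && s.2.1.isEmpty)
    (f := fun s => _root_.twoGraphs ([], [], s.2.2)) (g := fun _ => none)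
    (.and (.isEmpty .fst) (.isEmpty PolyTime.self.snd'.fst'))
    (h3.comp PolyTime.self.snd'.snd') (.const _)).congr ?_
  rintro ⟨_ | _, _ | _, gs⟩ <;> rfl

theorem PolyTime.decideContainment : PolyTime decideContainment := by
  have h1 : PolyTime parsePair := by
    refine .optionCases (f := fun _ => none) .parse (.const _) (.comp .twoGraphs .snd) ?_ ?_
    · intro w hw
      rw [parsePair, hw, Option.bind_none]
    · intro w s hw
      rw [parsePair, hw, Option.bind_some]
  have h2 : PolyTime fun x : GraphCode × GraphCode =>
      _root_.classTest x.1.edges && (_root_.classTest x.2.edges && _root_.embedTest x.1 x.2) :=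
    .and (PolyTime.classTest.comp PolyTime.self.fst'.edges)
      (.and (PolyTime.classTest.comp PolyTime.self.snd'.edges) .embedTest)
  refine .optionCases (f := fun _ => false) h1 (.const _) (h2.comp .snd) ?_ ?_
  · intro w hw
    rw [_root_.decideContainment, hw]
    rfl
  · intro w x hw
    rw [_root_.decideContainment, hw]
    rfl

end StackProg

/-- Containment for `DetShEx₀⁻` is in P. -/
theorem mainTheorem2 :
    InPolyTime (containmentProblem fun H : LGraph BWord => H.IsDetShExZeroMinus) :=
  ⟨decideContainment, decideContainment_iff, PolyTime.decideContainment.nonempty⟩
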